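/- Let $K$ be a field. For integers $m\ge 0$, $t\ge 1$ let $P_m$ be the path graph on the vertices $1,\dots,m$ and let $I_{m,t}\subseteq K[x_1,\dots,x_m]$ be its $t$-path ideal, generated by the products of the variables along the paths of $P_m$ on $t$ vertices. For $j\ge 1$ let $I_{m,t}^{[j]}$ be its $j$-th squarefree power, generated by the squarefree minimal monomial generators of $I_{m,t}^{\,j}$, and let $\Delta_{m,t}^{[j]}=\{[m]\setminus F: x_F\in I_{m,t}^{[j]}\}$ be the Alexander dual of the Stanley--Reisner complex of $I_{m,t}^{[j]}$; here $x_F=\prod_{i\in F}x_i$. Let $\Delta_{m,t}^{[0]}$ be the full simplex on $[m]$. A complex and its geometric realization are denoted by the same symbol, and $\Sigma(\Delta)$ denotes the suspension of $\Delta$, i.e. the join of $\Delta$ with two points (so $\Sigma(\{\emptyset\})=S^0$). Let $n,k,t\ge 0$ be integers with $t\geq 1$ and $n-kt>t$. Let $G_{n,t}^{[k]}$ be the directed graph with vertex set $$\{(m,j)\in\mathbb{N}^2 : 0\le j\le k,\ jt\le m\le n-(k-j)t\}$$ in which every vertex $(m,j)$ with $j>0$ and $m\ge jt+t+1$ has exactly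 the outgoing edges $(m,j)\to(m-t,j-1)$ with label $0$, $(m,j)\to(m-t-1,j-1)$ with label $1$, and $(m,j)\to(m-t-1,j)$ with label $2$. The leaves are the vertices $(m,j)$ with $1\le j\le k$ and $jt\le m\le jt+t$. For a leaf $(m,j)$ and $\alpha\ge 0$ let $N_{n,k}(m,j,\alpha)$ be the (finite) number of directed paths from $(n,k)$ to $(m,j)$ whose edge labels sum to $\alpha$. Then $$\Delta_{n,t}^{[k]}\ \simeq\ \bigvee_{(m,j)\ \text{leaf}}\ \bigvee_{\alpha\ge 0}\ \bigvee_{N_{n,k}(m,j,\alpha)}\Sigma^{\alpha}\bigl(\Delta_{m,t}^{[j]}\bigr),$$ where the empty wedge is a point. Here every space occurring as a summand is non-empty, and the homotopy equivalence holds for every choice of base points in the summands. -/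

import Mathlib

open scoped ContinuousMap

namespace SquarefreePath

noncomputable section

/-! ### Simplicial complexes, suspensions, realizations -/

/-- A simplicial complex on the finite vertex set `V`: a family of subsets of `V` closed under
taking subsets. The empty face is recorded (unlike in Mathlib's `PreAbstractSimplicialComplex`),
because Alexander duality and joins need it. The complex called "empty" is the one whose only face
is `∅`. Elements of `V` need not be faces. -/
@[ext]
structure FaceComplex (V : Type) where
  faces : Set (Finset V)
  down_closed : ∀ s ∈ faces, ∀ r ⊆ s, r ∈ faces

/-- The full simplex on `V`. -/
def simplex (V : Type) : FaceComplex V where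
  faces := Set.univ
  down_closed := fun _ _ _ _ => Set.mem_univ _

/-- The complex with exactly two vertices and no edge between them. -/
def twoPoints : FaceComplex Bool where
  faces := {s | s.card ≤ 1}
  down_closed := fun _ hs _ hr => (Finset.card_le_card hr).trans hs

/-- The join: faces are the disjoint unions of a face of `Δ` and a face of `Γ`. -/
def FaceComplex.join {V W : Type} (Δ : FaceComplex V) (Γ : FaceComplex W) : FaceComplex (V ⊕ W) where
  faces := {s | s.toLeft ∈ Δ.faces ∧ s.toRight ∈ Γ.faces}
  down_closed := fun _ hs _ hr =>
    ⟨Δ.down_closed _ hs.1 _ (Finset.toLeft_subset_toLeft hr),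
      Γ.down_closed _ hs.2 _ (Finset.toRight_subset_toRight hr)⟩

/-- The suspension: the join with two points. The suspension of `{∅}` is the complex of two
points, that is, `S⁰`. -/
def FaceComplex.suspension {V : Type} (Δ : FaceComplex V) : FaceComplex (V ⊕ Bool) :=
  Δ.join twoPoints

/-- The vertex set of the `α`-fold suspension. -/
def SuspVertex (V : Type) : ℕ → Type
  | 0 => V
  | α + 1 => SuspVertex V α ⊕ Bool

instance SuspVertex.instFintype (V : Type) [Fintype V] : (α : ℕ) → Fintype (SuspVertex V α)
  | 0 => inferInstanceAs (Fintype V)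
  | α + 1 =>
    letI := SuspVertex.instFintype V α
    inferInstanceAs (Fintype (SuspVertex V α ⊕ Bool))

/-- The `α`-fold iterated suspension `Σ^α(Δ)`. -/
def FaceComplex.iterSuspension {V : Type} (Δ : FaceComplex V) : (α : ℕ) → FaceComplex (SuspVertex V α)
  | 0 => Δ
  | α + 1 => (Δ.iterSuspension α).suspension

/-- The geometric realization of a complex on a finite vertex set: the points of the standard
simplex (in barycentric coordinates) supported on a face, as a subspace of `V → ℝ`. -/
def FaceComplex.realization {V : Type} [Fintype V] (Δ : FaceComplex V) : Set (V → ℝ) :=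
  {x | x ∈ stdSimplex ℝ V ∧ ∃ s ∈ Δ.faces, ∀ v ∉ s, x v = 0}

/-! ### Wedge sums -/

/-- The gluing relation of a wedge: each base point `p i` is identified with one extra point. -/
inductive WedgeRel {ι : Type} (X : ι → Type) (p : ∀ i, X i) :
    (Unit ⊕ (Σ i, X i)) → (Unit ⊕ (Σ i, X i)) → Prop
  | glue (i : ι) : WedgeRel X p (Sum.inr ⟨i, p i⟩) (Sum.inl ())

/-- The wedge sum of the spaces `X i` at the base points `p i`, with the quotient topology.
The empty wedge is a point. -/
abbrev Wedge {ι : Type} (X : ι → Type) [∀ i, TopologicalSpace (X i)] (p : ∀ i, X i) : Type :=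
  Quot (WedgeRel X p)

/-! ### Path ideals, squarefree powers, and the complexes `Δ_{n,t}^{[k]}` -/

section Ideals

variable (K : Type*) [Field K]

/-- The `t`-path ideal of a graph: generated by the products of the variables along the paths
on `t` vertices. -/
def pathIdeal {V : Type} (G : SimpleGraph V) (t : ℕ) : Ideal (MvPolynomial V K) :=
  Ideal.span {f | ∃ (u v : V) (p : G.Walk u v), p.IsPath ∧ p.support.length = t ∧
    f = (p.support.map (fun i => (MvPolynomial.X i : MvPolynomial V K))).prod}

variable {K}

/-- The exponents of the minimal monomial generators of a monomial ideal: the monomials of `J`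
that are minimal with respect to divisibility. -/
def minimalMonomials {V : Type} (J : Ideal (MvPolynomial V K)) : Set (V →₀ ℕ) :=
  {u | Minimal (fun w => MvPolynomial.monomial w (1 : K) ∈ J) u}

/-- The `k`-th squarefree power `I^{[k]}`: generated by the squarefree minimal monomial
generators of `I ^ k`. -/
def squarefreePower {V : Type} (I : Ideal (MvPolynomial V K)) (k : ℕ) :
    Ideal (MvPolynomial V K) :=
  Ideal.span ((fun u => MvPolynomial.monomial u (1 : K)) ''
    {u | u ∈ minimalMonomials (I ^ k) ∧ ∀ i, u i ≤ 1})

/-- The Stanley-Reisner complex of a squarefree monomial ideal `I`: the non-faces are the sets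
`F` with `x_F ∈ I`. -/
def stanleyReisnerComplex {V : Type} [DecidableEq V] (I : Ideal (MvPolynomial V K)) :
    FaceComplex V where
  faces := {F | ∏ i ∈ F, (MvPolynomial.X i : MvPolynomial V K) ∉ I}
  down_closed := by
    intro s hs r hr h
    apply hs
    rw [← Finset.prod_sdiff hr]
    exact I.mul_mem_left _ h

/-- The Alexander dual: the complements of the non-faces. -/
def FaceComplex.alexanderDual {V : Type} [Fintype V] [DecidableEq V] (Δ : FaceComplex V) :
    FaceComplex V where
  faces := {G | ∃ F, F ∉ Δ.faces ∧ G = Fᶜ}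
  down_closed := by
    rintro s ⟨F, hF, rfl⟩ r hr
    refine ⟨rᶜ, fun h => hF (Δ.down_closed _ h _ ?_), (compl_compl r).symm⟩
    intro x hx
    rw [Finset.mem_compl]
    intro hxr
    exact (Finset.mem_compl.mp (hr hxr)) hx

variable (K)

/-- `Δ_{n,t}^{[k]}`: for `k ≥ 1` the Alexander dual of the Stanley-Reisner complex of the `k`-th
squarefree power of the `t`-path ideal of the path graph on `n` vertices, and for `k = 0` the
simplex on the `n` vertices. -/
def pathDual (n t k : ℕ) : FaceComplex (Fin n) :=
  if k = 0 then simplex (Fin n)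
  else (stanleyReisnerComplex
    (squarefreePower (pathIdeal K (SimpleGraph.pathGraph n) t) k)).alexanderDual

end Ideals

/-! ### The labelled directed graph `G_{n,t}^{[k]}` -/

/-- The vertices `(m, j)` of `G_{n,t}^{[k]}`: those with `0 ≤ j ≤ k` and
`j t ≤ m ≤ n - (k - j) t`. -/
abbrev GVertex (n k t : ℕ) : Type :=
  {v : ℕ × ℕ // v.2 ≤ k ∧ v.2 * t ≤ v.1 ∧ v.1 + (k - v.2) * t ≤ n}

/-- Type A: `(m, j) → (m - t, j - 1)`. -/
def IsEdgeA (t : ℕ) (u v : ℕ × ℕ) : Prop := u.1 = v.1 + t ∧ u.2 = v.2 + 1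

/-- Type B: `(m, j) → (m - t - 1, j - 1)`. -/
def IsEdgeB (t : ℕ) (u v : ℕ × ℕ) : Prop := u.1 = v.1 + t + 1 ∧ u.2 = v.2 + 1

/-- Type C: `(m, j) → (m - t - 1, j)`. -/
def IsEdgeC (t : ℕ) (u v : ℕ × ℕ) : Prop := u.1 = v.1 + t + 1 ∧ u.2 = v.2

/-- The directed graph `G_{n,t}^{[k]}`: edges start at the vertices `(m, j)` with `j > 0` and
`m ≥ j t + t + 1`. -/
def reductionGraph (n k t : ℕ) : Digraph (GVertex n k t) where
  Adj u v := 0 < u.1.2 ∧ u.1.2 * t + t + 1 ≤ u.1.1 ∧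
    (IsEdgeA t u.1 v.1 ∨ IsEdgeB t u.1 v.1 ∨ IsEdgeC t u.1 v.1)

open Classical in
/-- The label of an edge: `0`, `1`, `2` for the types A, B, C (which exclude one another). -/
def edgeLabel (t : ℕ) (u v : ℕ × ℕ) : ℕ :=
  if IsEdgeA t u v then 0 else if IsEdgeB t u v then 1 else 2

/-- The leaves `(m, j)` of `G_{n,t}^{[k]}`: `1 ≤ j ≤ k` and `j t ≤ m ≤ j t + t` (two of these
inequalities hold for every vertex). -/
abbrev Leaf (n k t : ℕ) : Type :=
  {v : GVertex n k t // 1 ≤ v.1.2 ∧ v.1.1 ≤ v.1.2 * t + t}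

/-- The list `P` is the sequence of vertices of a directed path from `(n, k)` to `v`. -/
def IsDirectedPath (n k t : ℕ) (v : GVertex n k t) (P : List (GVertex n k t)) : Prop :=
  P.head?.map Subtype.val = some (n, k) ∧ P.getLast? = some v ∧ P.IsChain (reductionGraph n k t).Adj

/-- The sum of the labels of the edges between consecutive entries of `P`. -/
def labelSum {n k t : ℕ} (P : List (GVertex n k t)) : ℕ :=
  ((P.zip P.tail).map (fun e => edgeLabel t e.1.1 e.2.1)).sum

/-- The directed paths from `(n, k)` to `v` with label sum `α`. -/
def pathsTo (n k t : ℕ) (v : GVertex n k t) (α : ℕ) : Set (List (GVertex n k t)) :=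
  {P | IsDirectedPath n k t v P ∧ labelSum P = α}

/-- `N_{n,k}(m, j, α)`: the number of directed paths from `(n, k)` to `v = (m, j)` with label
sum `α`. -/
def numPaths (n k t : ℕ) (v : GVertex n k t) (α : ℕ) : ℕ := (pathsTo n k t v α).ncard

/-- There are only finitely many paths, so that `numPaths` is their true number. -/
theorem finite_pathsTo (n k t : ℕ) (ht : 1 ≤ t) (v : GVertex n k t) (α : ℕ) :
    (pathsTo n k t v α).Finite := by
  have hfin : Finite (GVertex n k t) := by
    apply Set.Finite.to_subtype
    apply (Set.finite_Iic ((n, k) : ℕ × ℕ)).subset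
    rintro ⟨m, j⟩ ⟨h1, -, h3⟩
    exact ⟨(Nat.le_add_right _ _).trans h3, h1⟩
  apply (List.finite_length_le (GVertex n k t) (Nat.card (GVertex n k t))).subset
  rintro P ⟨⟨-, -, hc⟩, -⟩
  have hnd : P.Nodup := by
    have hc' : P.IsChain (fun u v => v.1.1 < u.1.1) := by
      refine hc.imp ?_
      rintro u v ⟨-, -, h⟩
      unfold IsEdgeA IsEdgeB IsEdgeC at h
      omega
    have : IsTrans (GVertex n k t) (fun u v => v.1.1 < u.1.1) :=
      ⟨fun _ _ _ h1 h2 => lt_trans h2 h1⟩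
    refine hc'.pairwise.imp ?_
    rintro u v h rfl
    exact lt_irrefl _ h
  have := Fintype.ofFinite (GVertex n k t)
  rw [Nat.card_eq_fintype_card]
  exact hnd.length_le_card

/-! ### The summands of the wedge -/

/-- The index set of the wedge: a leaf `(m, j)`, an integer `α ≥ 0`, and one of
`N_{n,k}(m, j, α)` copies. -/
abbrev WedgeIndex (n k t : ℕ) : Type :=
  Σ v : Leaf n k t, Σ α : ℕ, Fin (numPaths n k t v.1 α)

/-- The summand `Σ^α(Δ_{m,t}^{[j]})` with index `((m, j), α, copy)`. -/
abbrev summand (K : Type*) [Field K] (n k t : ℕ) (i : WedgeIndex n k t) : Type :=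
  ((pathDual K i.1.1.1.1 t i.1.1.1.2).iterSuspension i.2.1).realization

end

end SquarefreePath

open SquarefreePath

open scoped ContinuousMap unitInterval
open SquarefreePath

namespace SquarefreePath

noncomputable section

/-! ### Pointed homotopy equivalences -/

section Pointed

variable {X Y Z : Type} [TopologicalSpace X] [TopologicalSpace Y] [TopologicalSpace Z]

/-! The combinatorial input is that a set `G` is a face of `Δ_{n,t}^{[k]}` exactly when its
complement contains `k` disjoint intervals of length `t`. Paths in a path graph are intervals, and
all generators of the `k`-th power have degree `kt`, so all of them are minimal
(`prod_mem_squarefreePower_iff`, `pathDual_eq`).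

The topological input is a splitting lemma (`IsSplit.exists_ptdEquiv_wedge2`). Suppose `Δ` is the
union of `A` and the star of a vertex `w` outside `A`, and their intersection `C` lies in a cone
inside `A`. Then `C` is null-homotopic in `A`, and `Δ ≃ A ∨ ΣC`. The proof retracts `Δ` onto `A`
together with the cone `w * C`, and then pinches that cone at half height by explicit formulas in
barycentric coordinates.

Two splittings give one recursion step for `k ≥ 1` and `n > kt + t`. With `w` the last vertex, `A`
is `Δ_{n-t}^{[k-1]}`. The remaining intersection `C` splits at the vertex `n-t` (index `n - t - 1`)
into `Δ_{n-t-1}^{[k-1]}` and `Δ_{n-t-1}^{[k]}`. Hence `Δ_n^{[k]} ≃ Δ_{n-t}^{[k-1]} ∨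
ΣΔ_{n-t-1}^{[k-1]} ∨ Σ²Δ_{n-t-1}^{[k]}`, and the three terms are the edges of labels 0, 1, 2.
Unfolding the recursion (`isWedge_pathComplex`) produces one summand per directed path to a leaf,
suspended as often as its labels sum to. Vertices with `j = 0` are nonempty simplices, hence
contractible, and contribute nothing.

Wedges respect only pointed equivalences, so base points are carried throughout and must be
exchangeable. A simplicial realization is conical near each point (`conicalAt`), so in a path
connected one any base point may replace any other (`PtdEquiv.of_joined`). Path connectedness is
part of the induction: every leaf is reached with enough suspensions, even when its complex is
`{∅}`. Splittings themselves can be suspended, so the induction runs over complexes `Σ^s Δ` and no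
equivalence ever has to be suspended. -/

theorem homotopicRel_of_function {f g : C(X, Y)} {S : Set X} (H : I × X → Y) (hc : Continuous H)
    (h0 : ∀ x, H (0, x) = f x) (h1 : ∀ x, H (1, x) = g x) (hS : ∀ s, ∀ x ∈ S, H (s, x) = f x) :
    f.HomotopicRel g S :=
  ⟨{ toFun := H
     continuous_toFun := hc
     map_zero_left := h0
     map_one_left := h1
     prop' := hS }⟩

theorem _root_.ContinuousMap.HomotopicRel.precomp {f g : C(Y, Z)} {S : Set Y}
    (h : f.HomotopicRel g S) (k : C(X, Y)) {T : Set X} (hk : ∀ x ∈ T, k x ∈ S) :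
    (f.comp k).HomotopicRel (g.comp k) T := by
  obtain ⟨H⟩ := h
  refine homotopicRel_of_function (fun z => H (z.1, k z.2)) (by fun_prop) ?_ ?_ ?_
  · intro x; simp
  · intro x; simp
  · intro s x hx
    exact H.eq_fst s (hk x hx)

/-- `(X, p)` and `(Y, q)` are homotopy equivalent as pointed spaces. -/
def PtdEquiv (X : Type) [TopologicalSpace X] (p : X) (Y : Type) [TopologicalSpace Y] (q : Y) :
    Prop :=
  ∃ (f : C(X, Y)) (g : C(Y, X)), f p = q ∧ g q = p ∧
    (g.comp f).HomotopicRel (ContinuousMap.id X) {p} ∧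
    (f.comp g).HomotopicRel (ContinuousMap.id Y) {q}

namespace PtdEquiv

theorem symm {p : X} {q : Y} (h : PtdEquiv X p Y q) : PtdEquiv Y q X p := by
  obtain ⟨f, g, h1, h2, h3, h4⟩ := h
  exact ⟨g, f, h2, h1, h4, h3⟩

theorem trans {p : X} {q : Y} {r : Z} (h : PtdEquiv X p Y q) (h' : PtdEquiv Y q Z r) :
    PtdEquiv X p Z r := by
  obtain ⟨f, g, h1, h2, h3, h4⟩ := h
  obtain ⟨f', g', h1', h2', h3', h4'⟩ := h'
  refine ⟨f'.comp f, g.comp g', by simp [h1, h1'], by simp [h2, h2'], ?_, ?_⟩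
  · have := (h3'.precomp f (T := {p}) (by simp [h1])).comp_continuousMap g
    exact this.trans h3
  · have := (h4.precomp g' (T := {r}) (by simp [h2'])).comp_continuousMap f'
    exact this.trans h4'

theorem of_homeomorph (e : X ≃ₜ Y) (p : X) : PtdEquiv X p Y (e p) := by
  refine ⟨e, e.symm, rfl, by simp, ?_, ?_⟩
  · convert ContinuousMap.HomotopicRel.refl _
    ext x; simp
  · convert ContinuousMap.HomotopicRel.refl _
    ext x; simp

theorem nonempty_homotopyEquiv {p : X} {q : Y} (h : PtdEquiv X p Y q) : Nonempty (X ≃ₕ Y) := by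
  obtain ⟨f, g, -, -, h3, h4⟩ := h
  exact ⟨⟨f, g, h3.homotopic, h4.homotopic⟩⟩

theorem pathConnectedSpace {p : X} {q : Y} (h : PtdEquiv X p Y q) [PathConnectedSpace Y] :
    PathConnectedSpace X := by
  obtain ⟨f, g, -, -, ⟨H⟩, -⟩ := h
  have key : ∀ x : X, Joined x (g (f x)) := fun x =>
    Joined.symm ⟨⟨⟨fun s => H (s, x), by fun_prop⟩, by simp, by simp⟩⟩
  refine ⟨⟨p⟩, fun x y => (key x).trans (Joined.trans ?_ (key y).symm)⟩
  exact (PathConnectedSpace.joined (f x) (f y)).map g.continuous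

end PtdEquiv

end Pointed

/-! ### Maps out of wedge sums -/

namespace Wedge

variable {ι : Type} {X : ι → Type} [∀ i, TopologicalSpace (X i)] {p : ∀ i, X i}
  {Z : Type} [TopologicalSpace Z]

/-- The common base point of a wedge. -/
def base (X : ι → Type) [∀ i, TopologicalSpace (X i)] (p : ∀ i, X i) : Wedge X p :=
  Quot.mk _ (Sum.inl ())

/-- The inclusion of a summand. -/
def incl (p : ∀ i, X i) (i : ι) : C(X i, Wedge X p) where
  toFun x := Quot.mk _ (Sum.inr ⟨i, x⟩)
  continuous_toFun := by
    exact continuous_quot_mk.comp (continuous_inr.comp continuous_sigmaMk)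

@[simp] theorem incl_base (i : ι) : incl p i (p i) = base X p := Quot.sound (WedgeRel.glue i)

/-- The map out of a wedge given by pointed maps on the summands. -/
def lift (f : ∀ i, C(X i, Z)) (z : Z) (h : ∀ i, f i (p i) = z) : C(Wedge X p, Z) where
  toFun := Quot.lift (Sum.elim (fun _ => z) (fun y => f y.1 y.2)) (by
    rintro _ _ ⟨i⟩
    exact h i)
  continuous_toFun := by
    refine continuous_quot_lift _ (continuous_const.sumElim ?_)
    exact continuous_sigma fun i => (f i).continuous

@[simp] theorem lift_base (f : ∀ i, C(X i, Z)) (z : Z) (h : ∀ i, f i (p i) = z) :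
    lift f z h (base X p) = z := rfl

@[simp] theorem lift_incl (f : ∀ i, C(X i, Z)) (z : Z) (h : ∀ i, f i (p i) = z) (i : ι) (x : X i) :
    lift f z h (incl p i x) = f i x := rfl

@[elab_as_elim]
theorem ind {P : Wedge X p → Prop} (hb : P (base X p)) (hi : ∀ i x, P (incl p i x)) (y) : P y := by
  induction y using Quot.ind with
  | mk y =>
    rcases y with ⟨⟩ | ⟨i, x⟩
    · exact hb
    · exact hi i x

/-- By currying, a homotopy is a map into the path space `C(I, Z)`, so the universal property of the
wedge applies directly and no quotient topology on `I × Wedge X p` has to be analysed. -/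
theorem exists_lift_prod (H : ∀ i, C(I × X i, Z)) (c : C(I, Z)) (h : ∀ i s, H i (s, p i) = c s) :
    ∃ K : C(I × Wedge X p, Z), (∀ s, K (s, base X p) = c s) ∧
      ∀ s i x, K (s, incl p i x) = H i (s, x) := by
  let k : ∀ i, C(X i, C(I, Z)) := fun i =>
    ContinuousMap.curry ⟨fun z : X i × I => H i (z.2, z.1), by fun_prop⟩
  have hk : ∀ i, k i (p i) = c := by
    intro i
    ext s
    exact h i s
  let K : C(Wedge X p, C(I, Z)) := lift k _ hk
  exact ⟨⟨fun z => K z.2 z.1, by fun_prop⟩, fun s => rfl, fun s i x => rfl⟩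

theorem homotopicRel {F G : C(Wedge X p, Z)} (hb : F (base X p) = G (base X p))
    (h : ∀ i, (F.comp (incl p i)).HomotopicRel (G.comp (incl p i)) {p i}) :
    F.HomotopicRel G {base X p} := by
  have H := fun i => (h i).some
  obtain ⟨K, hK1, hK2⟩ := exists_lift_prod (fun i => (H i).toContinuousMap)
    (ContinuousMap.const I (F (base X p))) (by
      intro i s
      have := (H i).eq_fst s (x := p i) rfl
      simpa using this)
  refine homotopicRel_of_function K (by fun_prop) ?_ ?_ ?_
  · intro x
    induction x using ind with
    | hb => rw [hK1]; rfl
    | hi i x => rw [hK2]; simp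
  · intro x
    induction x using ind with
    | hb => rw [hK1]; exact hb
    | hi i x => rw [hK2]; simp
  · rintro s x rfl
    exact hK1 s

theorem pathConnectedSpace (h : ∀ i, PathConnectedSpace (X i)) : PathConnectedSpace (Wedge X p) := by
  have key : ∀ x : Wedge X p, Joined (base X p) x := by
    intro x
    induction x using ind with
    | hb => exact Joined.refl _
    | hi i x =>
      rw [← incl_base i]
      exact (PathConnectedSpace.joined (p i) x).map (incl p i).continuous
  exact ⟨⟨base X p⟩, fun x y => (key x).symm.trans (key y)⟩

/-- Wedges with matching summands are homeomorphic. -/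
theorem ptdEquiv_congr {κ : Type} {Y : κ → Type} [∀ i, TopologicalSpace (Y i)] {q : ∀ i, Y i}
    (e : ι ≃ κ) (f : ∀ i, X i ≃ₜ Y (e i)) (hf : ∀ i, f i (p i) = q (e i)) :
    PtdEquiv (Wedge X p) (base X p) (Wedge Y q) (base Y q) := by
  let F : C(Wedge X p, Wedge Y q) :=
    lift (fun i => (incl q (e i)).comp (f i)) (base Y q) (by intro i; simp [hf])
  -- The inverse on the summand `k` is obtained through properties only, because the index `i` with
  -- `e i = k` would otherwise force transports into its definition.
  have h : ∀ k, ∃ g : C(Y k, Wedge X p), g (q k) = base X p ∧ (∀ y, F (g y) = incl q k y) ∧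
      ∀ i (hi : e i = k) (x : X i), g (hi ▸ f i x) = incl p i x := by
    intro k
    obtain ⟨i, rfl⟩ := e.surjective k
    refine ⟨(incl p i).comp (f i).symm, ?_, ?_, ?_⟩
    · simp [← hf]
    · intro y
      simp [F]
    · intro i' hi x
      obtain rfl := e.injective hi
      simp
  choose g hg1 hg2 hg3 using h
  refine ⟨F, lift g _ hg1, rfl, rfl, ?_, ?_⟩
  · convert ContinuousMap.HomotopicRel.refl _
    ext x
    induction x using ind with
    | hb => rfl
    | hi i x => exact (hg3 (e i) i rfl x).symm
  · convert ContinuousMap.HomotopicRel.refl _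
    ext x
    induction x using ind with
    | hb => rfl
    | hi i x => exact (hg2 i x).symm

theorem ptdEquiv_of_unique [Unique ι] {q : Z} (e : Z ≃ₜ X default) (hq : e q = p default) :
    PtdEquiv Z q (Wedge X p) (base X p) := by
  refine ⟨(incl p default).comp e, lift (fun i => (e.symm : C(X default, Z)).comp
    ⟨fun x => Unique.eq_default i ▸ x, ?_⟩) q ?_, ?_, rfl, ?_, ?_⟩
  · obtain rfl := Unique.eq_default i
    exact continuous_id
  · intro i
    obtain rfl := Unique.eq_default i
    simp [← hq]
  · simp [hq]
  · convert ContinuousMap.HomotopicRel.refl _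
    ext x
    simp
  · convert ContinuousMap.HomotopicRel.refl _
    ext x
    induction x using ind with
    | hb => simp [hq]
    | hi i x =>
      obtain rfl := Unique.eq_default i
      simp

end Wedge

/-! ### Wedge sums of two spaces -/

/-- The family of two spaces indexed by `Bool`. -/
def BoolFam (X Y : Type) : Bool → Type
  | false => X
  | true => Y

instance (X Y : Type) [TopologicalSpace X] [TopologicalSpace Y] :
    ∀ b, TopologicalSpace (BoolFam X Y b)
  | false => inferInstanceAs (TopologicalSpace X)
  | true => inferInstanceAs (TopologicalSpace Y)

/-- The base points of a family of two spaces. -/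
def BoolFam.pt {X Y : Type} (p : X) (q : Y) : ∀ b, BoolFam X Y b
  | false => p
  | true => q

/-- The wedge of two pointed spaces. -/
abbrev Wedge2 (X : Type) [TopologicalSpace X] (p : X) (Y : Type) [TopologicalSpace Y] (q : Y) :
    Type := Wedge (BoolFam X Y) (BoolFam.pt p q)

namespace Wedge2

variable {X Y Z : Type} [TopologicalSpace X] [TopologicalSpace Y] [TopologicalSpace Z]
  {p : X} {q : Y}

/-- The base point. -/
def base (p : X) (q : Y) : Wedge2 X p Y q := Wedge.base _ _

/-- The first summand. -/
def inl (p : X) (q : Y) : C(X, Wedge2 X p Y q) := Wedge.incl (BoolFam.pt p q) false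

/-- The second summand. -/
def inr (p : X) (q : Y) : C(Y, Wedge2 X p Y q) := Wedge.incl (BoolFam.pt p q) true

@[simp] theorem inl_base : inl p q p = base p q := Wedge.incl_base (p := BoolFam.pt p q) false

@[simp] theorem inr_base : inr p q q = base p q := Wedge.incl_base (p := BoolFam.pt p q) true

/-- The map given by two maps that agree at the base points. -/
def lift (f : C(X, Z)) (g : C(Y, Z)) (h : f p = g q) : C(Wedge2 X p Y q, Z) :=
  Wedge.lift (p := BoolFam.pt p q) (fun b => match b with | false => f | true => g) (f p) (by
    rintro (_ | _)
    · rfl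
    · exact h.symm)

@[simp] theorem lift_inl (f : C(X, Z)) (g : C(Y, Z)) (h : f p = g q) (x : X) :
    lift f g h (inl p q x) = f x := rfl

@[simp] theorem lift_inr (f : C(X, Z)) (g : C(Y, Z)) (h : f p = g q) (y : Y) :
    lift f g h (inr p q y) = g y := rfl

@[simp] theorem lift_base (f : C(X, Z)) (g : C(Y, Z)) (h : f p = g q) :
    lift f g h (base p q) = f p := rfl

theorem homotopicRel {F G : C(Wedge2 X p Y q, Z)} (hb : F (base p q) = G (base p q))
    (h1 : (F.comp (inl p q)).HomotopicRel (G.comp (inl p q)) {p})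
    (h2 : (F.comp (inr p q)).HomotopicRel (G.comp (inr p q)) {q}) :
    F.HomotopicRel G {base p q} := by
  refine Wedge.homotopicRel hb ?_
  rintro (_ | _)
  · exact h1
  · exact h2

theorem hom_ext {F G : C(Wedge2 X p Y q, Z)} (h1 : ∀ x, F (inl p q x) = G (inl p q x))
    (h2 : ∀ y, F (inr p q y) = G (inr p q y)) : F = G := by
  ext x
  induction x using Wedge.ind with
  | hb => have := h1 p; rw [inl_base] at this; exact this
  | hi i x =>
    cases i
    · exact h1 x
    · exact h2 x

open Classical in
/-- The map into a wedge of two spaces whose components are `a` and `b`. -/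
def pair [T1Space X] [T1Space Y] (p : X) (q : Y) (a : C(Z, X)) (b : C(Z, Y))
    (h : ∀ z, a z = p ∨ b z = q) : C(Z, Wedge2 X p Y q) where
  toFun z := if b z = q then inl p q (a z) else inr p q (b z)
  continuous_toFun := by
    -- Points are closed, so the sets where one component sits at the base point form a closed cover
    -- of `Z`. On their overlap both formulas give the wedge point.
    have hA : IsClosed {z | b z = q} := isClosed_singleton.preimage b.continuous
    have hB : IsClosed {z | a z = p} := isClosed_singleton.preimage a.continuous
    rw [← continuousOn_univ]
    have hU : (Set.univ : Set Z) = {z | b z = q} ∪ {z | a z = p} := by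
      ext z
      simpa [or_comm] using h z
    rw [hU]
    refine ContinuousOn.union_of_isClosed ?_ ?_ hA hB
    · refine ((inl p q).continuous.comp a.continuous).continuousOn.congr ?_
      intro z hz
      exact if_pos hz
    · refine ((inr p q).continuous.comp b.continuous).continuousOn.congr ?_
      intro z hz
      simp only [Function.comp]
      split_ifs with hb
      · rw [hz, hb, inl_base, inr_base]
      · rfl

section

variable [T1Space X] [T1Space Y] (a : C(Z, X)) (b : C(Z, Y)) (h : ∀ z, a z = p ∨ b z = q)

theorem pair_of_right {z : Z} (hz : b z = q) : pair p q a b h z = inl p q (a z) := if_pos hz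

theorem pair_of_left {z : Z} (hz : a z = p) : pair p q a b h z = inr p q (b z) := by
  by_cases hb : b z = q
  · rw [pair_of_right _ _ _ hb, hb, hz, inl_base, inr_base]
  · exact if_neg hb

theorem pair_congr {Z' : Type} [TopologicalSpace Z'] {a' : C(Z', X)} {b' : C(Z', Y)}
    {h' : ∀ z, a' z = p ∨ b' z = q} {z : Z} {z' : Z'} (ha : a z = a' z') (hb : b z = b' z') :
    pair p q a b h z = pair p q a' b' h' z' := by
  by_cases hz : b z = q
  · rw [pair_of_right _ _ _ hz, pair_of_right _ _ _ (hb ▸ hz), ha]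
  · have hz' := (h z).resolve_right hz
    rw [pair_of_left _ _ _ hz', pair_of_left _ _ _ (ha ▸ hz'), hb]

/-- Homotopies between maps into a wedge of two spaces, given by components. -/
theorem pair_homotopicRel {a' : C(Z, X)} {b' : C(Z, Y)} {h' : ∀ z, a' z = p ∨ b' z = q} {S : Set Z}
    (A : C(I × Z, X)) (B : C(I × Z, Y)) (hAB : ∀ z, A z = p ∨ B z = q)
    (hA0 : ∀ z, A (0, z) = a z) (hB0 : ∀ z, B (0, z) = b z)
    (hA1 : ∀ z, A (1, z) = a' z) (hB1 : ∀ z, B (1, z) = b' z)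
    (hAS : ∀ s, ∀ z ∈ S, A (s, z) = a z) (hBS : ∀ s, ∀ z ∈ S, B (s, z) = b z) :
    (pair p q a b h).HomotopicRel (pair p q a' b' h') S := by
  refine homotopicRel_of_function (pair p q A B hAB) (by fun_prop) ?_ ?_ ?_
  · exact fun z => pair_congr _ _ _ (hA0 z) (hB0 z)
  · exact fun z => pair_congr _ _ _ (hA1 z) (hB1 z)
  · exact fun s z hz => pair_congr _ _ _ (hAS s z hz) (hBS s z hz)

end

/-- Two wedge decompositions combine. -/
theorem ptdEquiv_sum {ι κ : Type} (W : ι ⊕ κ → Type) [∀ i, TopologicalSpace (W i)] (w : ∀ i, W i)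
    (h1 : PtdEquiv X p (Wedge (fun i => W (Sum.inl i)) (fun i => w (Sum.inl i))) (Wedge.base _ _))
    (h2 : PtdEquiv Y q (Wedge (fun i => W (Sum.inr i)) (fun i => w (Sum.inr i))) (Wedge.base _ _)) :
    PtdEquiv (Wedge2 X p Y q) (base p q) (Wedge W w) (Wedge.base W w) := by
  obtain ⟨f1, g1, a1, b1, c1, d1⟩ := h1
  obtain ⟨f2, g2, a2, b2, c2, d2⟩ := h2
  let J1 : C(Wedge (fun i => W (Sum.inl i)) (fun i => w (Sum.inl i)), Wedge W w) :=
    Wedge.lift (fun i => Wedge.incl w (Sum.inl i)) (Wedge.base W w) (fun i => Wedge.incl_base _)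
  let J2 : C(Wedge (fun i => W (Sum.inr i)) (fun i => w (Sum.inr i)), Wedge W w) :=
    Wedge.lift (fun i => Wedge.incl w (Sum.inr i)) (Wedge.base W w) (fun i => Wedge.incl_base _)
  have hJ1 : J1 (f1 p) = Wedge.base W w := by rw [a1]; rfl
  have hJ2 : J2 (f2 q) = Wedge.base W w := by rw [a2]; rfl
  let F : C(Wedge2 X p Y q, Wedge W w) := lift (J1.comp f1) (J2.comp f2) (hJ1.trans hJ2.symm)
  let G : C(Wedge W w, Wedge2 X p Y q) := Wedge.lift (fun i => match i with
    | Sum.inl i => ((inl p q).comp g1).comp (Wedge.incl (fun i => w (Sum.inl i)) i)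
    | Sum.inr i => ((inr p q).comp g2).comp (Wedge.incl (fun i => w (Sum.inr i)) i)) (base p q) (by
      rintro (i | i)
      · simp [Wedge.incl_base (p := fun i => w (Sum.inl i)), b1]
      · simp [Wedge.incl_base (p := fun i => w (Sum.inr i)), b2])
  have hG1 : G.comp J1 = (inl p q).comp g1 := by
    ext x
    induction x using Wedge.ind with
    | hb => simp [b1, J1, G]
    | hi i x => simp [J1, G]
  have hG2 : G.comp J2 = (inr p q).comp g2 := by
    ext x
    induction x using Wedge.ind with
    | hb => simp [b2, J2, G]
    | hi i x => simp [J2, G]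
  have hF : F (base p q) = Wedge.base W w := hJ1
  refine ⟨F, G, hF, rfl, ?_, ?_⟩
  · refine homotopicRel ?_ ?_ ?_
    · simp [hF, G]
    · have : (G.comp F).comp (inl p q) = (inl p q).comp (g1.comp f1) := by
        change (G.comp J1).comp f1 = _
        rw [hG1]; rfl
      rw [this]
      exact c1.comp_continuousMap (inl p q)
    · have : (G.comp F).comp (inr p q) = (inr p q).comp (g2.comp f2) := by
        change (G.comp J2).comp f2 = _
        rw [hG2]; rfl
      rw [this]
      exact c2.comp_continuousMap (inr p q)
  · refine Wedge.homotopicRel ?_ ?_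
    · simp [hF, G]
    · rintro (i | i)
      · exact (d1.precomp (Wedge.incl _ i) (T := {w (Sum.inl i)})
          (by simp)).comp_continuousMap J1
      · exact (d2.precomp (Wedge.incl _ i) (T := {w (Sum.inr i)})
          (by simp)).comp_continuousMap J2

end Wedge2

/-! ### Change of base points -/

section Whisker

variable {X Y Z : Type} [TopologicalSpace X] [TopologicalSpace Y] [TopologicalSpace Z]

/-- The space `X` with an interval attached at `p`. -/
abbrev Whisker (X : Type) [TopologicalSpace X] (p : X) : Type := Wedge2 X p I 0

namespace Whisker

/-- The free end of the interval. -/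
def tip (p : X) : Whisker X p := Wedge2.inr p 0 1

/-- The interval as a path. -/
def path (p : X) : Path (Wedge2.inl p (0 : I) p) (tip p) where
  toContinuousMap := Wedge2.inr p 0
  source' := by simp
  target' := rfl

theorem exists_homotopy {p : X} (A : C(I × X, Z)) (B : C(I × I, Z))
    (h : ∀ s, A (s, p) = B (s, 0)) :
    ∃ K : C(I × Whisker X p, Z), (∀ s x, K (s, Wedge2.inl p 0 x) = A (s, x)) ∧
      ∀ s y, K (s, Wedge2.inr p 0 y) = B (s, y) := by
  obtain ⟨K, -, hK⟩ := Wedge.exists_lift_prod (p := BoolFam.pt p (0 : I))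
    (fun b => match b with | false => A | true => B) ⟨fun s => A (s, p), by fun_prop⟩ (by
      rintro (_ | _) s
      · rfl
      · exact (h s).symm)
  exact ⟨K, fun s x => hK s false x, fun s x => hK s true x⟩

theorem homotopicRel {p : X} {F G : C(Whisker X p, Z)} (A : C(I × X, Z)) (B : C(I × I, Z))
    (h : ∀ s, A (s, p) = B (s, 0)) (hA0 : ∀ x, A (0, x) = F (Wedge2.inl p 0 x))
    (hA1 : ∀ x, A (1, x) = G (Wedge2.inl p 0 x)) (hB0 : ∀ y, B (0, y) = F (Wedge2.inr p 0 y))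
    (hB1 : ∀ y, B (1, y) = G (Wedge2.inr p 0 y)) (ht : ∀ s, B (s, 1) = F (tip p)) :
    F.HomotopicRel G {tip p} := by
  obtain ⟨K, h1, h2⟩ := exists_homotopy A B h
  refine homotopicRel_of_function K K.continuous ?_ ?_ ?_
  · intro x
    exact DFunLike.congr_fun (Wedge2.hom_ext (F := K.comp (.prodMk (.const _ 0) (.id _))) (G := F)
      (fun x => (h1 0 x).trans (hA0 x)) (fun x => (h2 0 x).trans (hB0 x))) x
  · intro x
    exact DFunLike.congr_fun (Wedge2.hom_ext (F := K.comp (.prodMk (.const _ 1) (.id _))) (G := G)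
      (fun x => (h1 1 x).trans (hA1 x)) (fun x => (h2 1 x).trans (hB1 x))) x
  · rintro s x rfl
    exact (h2 s 1).trans (ht s)

/-- Dragging the whisker along a path. -/
def drag {p q : X} (γ : Path p q) : C(Whisker X p, Whisker X q) :=
  Wedge2.lift (Wedge2.inl q 0)
    ((γ.map (Wedge2.inl q (0 : I)).continuous).trans (path q)).toContinuousMap (by simp)

theorem drag_tip {p q : X} (γ : Path p q) : drag γ (tip p) = tip q :=
  ((γ.map (Wedge2.inl q (0 : I)).continuous).trans (path q)).target

/-- The composite is the identity on `X` and sends the whisker to `γ`, then `γ` backwards, then the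
whisker. The detour contracts with fixed ends, so neither `X` nor the tip has to move. -/
theorem drag_comp_drag {p q : X} (γ : Path p q) :
    ((drag γ.symm).comp (drag γ)).HomotopicRel (ContinuousMap.id _) {tip p} := by
  have hP : ((γ.map (Wedge2.inl p (0 : I)).continuous).trans
      ((γ.symm.map (Wedge2.inl p (0 : I)).continuous).trans (path p))).Homotopic (path p) := by
    refine Path.Homotopic.trans ⟨(Path.Homotopy.transAssoc _ _ _).symm⟩
      (Path.Homotopic.trans ?_ ⟨Path.Homotopy.reflTrans _⟩)
    refine Path.Homotopic.hcomp ?_ (Path.Homotopic.refl _)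
    rw [← Path.map_symm]
    exact ⟨(Path.Homotopy.reflTransSymm _).symm⟩
  obtain ⟨H⟩ := hP
  refine homotopicRel ⟨fun z => Wedge2.inl p 0 z.2, by fun_prop⟩ H.toContinuousMap ?_ ?_ ?_ ?_ ?_ ?_
  · intro s
    exact (H.source s).symm
  · intro x; rfl
  · intro x; rfl
  · intro y
    refine (H.apply_zero y).trans ?_
    change _ = drag γ.symm (((γ.map (Wedge2.inl q (0 : I)).continuous).trans (path q)) y)
    rw [Path.coe_toContinuousMap, Path.trans_apply, Path.trans_apply]
    split_ifs
    · rfl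
    · rfl
  · intro y
    exact H.apply_one y
  · intro s
    refine (H.target s).trans ?_
    change tip p = drag γ.symm (drag γ (tip p))
    rw [drag_tip, drag_tip]

theorem ptdEquiv_of_path {p q : X} (γ : Path p q) :
    PtdEquiv (Whisker X p) (tip p) (Whisker X q) (tip q) := by
  refine ⟨drag γ, drag γ.symm, drag_tip _, drag_tip _, drag_comp_drag γ, ?_⟩
  simpa using drag_comp_drag γ.symm

end Whisker

/-- A form of local contractibility at `p`: a deformation of `X` that fixes `p` ends in a map which
is constant near `p`. -/
def ConicalAt (p : X) : Prop :=
  ∃ (ω : C(X, I)) (r : C(X, X)), ω p = 1 ∧ (ContinuousMap.id X).HomotopicRel r {p} ∧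
    ∀ x, r x = p ∨ ω x = 0

/-- Where `r` has collapsed a neighbourhood of `p`, the function `ω` is free to stretch this
neighbourhood along the whisker until `p` arrives at the tip. The inverse collapses the whisker. -/
theorem ConicalAt.ptdEquiv_whisker [T1Space X] {p : X} (h : ConicalAt p) :
    PtdEquiv X p (Whisker X p) (Whisker.tip p) := by
  obtain ⟨ω, r, hω, hr, h⟩ := h
  have hrp : r p = p := (hr.fst_eq_snd rfl).symm
  let f : C(X, Whisker X p) := Wedge2.pair p 0 r ω h
  let g : C(Whisker X p, X) := Wedge2.lift (ContinuousMap.id X) (ContinuousMap.const I p) rfl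
  have hf : f p = Whisker.tip p := by
    rw [Wedge2.pair_of_left _ _ _ hrp, hω]; rfl
  refine ⟨f, g, hf, rfl, ?_, ?_⟩
  · have : g.comp f = r := by
      ext x
      rcases h x with hx | hx
      · exact (congrArg g (Wedge2.pair_of_left _ _ h hx)).trans hx.symm
      · exact congrArg g (Wedge2.pair_of_right _ _ h hx)
    rw [this]
    exact hr.symm
  -- `M` applies `r` on `X` and fixes the whisker. The identity deforms to `M` by the given
  -- deformation, and `M` then deforms to `f ∘ g` by pushing along the whisker.
  · let M : C(Whisker X p, Whisker X p) :=
      Wedge2.lift ((Wedge2.inl p 0).comp r) (Wedge2.inr p 0) (by simp [hrp])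
    have h1 : (ContinuousMap.id _).HomotopicRel M {Whisker.tip p} := by
      obtain ⟨H⟩ := hr
      refine Whisker.homotopicRel ((Wedge2.inl p 0).comp H.toContinuousMap)
        ⟨fun z => Wedge2.inr p 0 z.2, by fun_prop⟩ ?_ ?_ ?_ ?_ ?_ ?_
      · intro s
        have := H.eq_fst s (x := p) rfl
        exact (congrArg (Wedge2.inl p 0) this).trans Wedge2.inl_base |>.trans
          Wedge2.inr_base.symm
      · intro x; simp
      · intro x; simp [M]
      · intro y; rfl
      · intro y; rfl
      · intro y; rfl
    have h2 : M.HomotopicRel (f.comp g) {Whisker.tip p} := by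
      refine Whisker.homotopicRel
        (Wedge2.pair p 0 (r.comp .snd) ⟨fun z : I × X => z.1 * ω z.2, by fun_prop⟩ ?_)
        -- The whisker coordinate is `1 - (1 - s)(1 - y)`: it moves `y` to the tip, fixes the tip,
        -- and at `y = 0` equals `s`, matching `s * ω p`.
        ⟨fun z => Wedge2.inr p 0 (σ (σ z.1 * σ z.2)), by fun_prop⟩ ?_ ?_ ?_ ?_ ?_ ?_
      · rintro ⟨s, x⟩
        rcases h x with hx | hx
        · exact Or.inl hx
        · exact Or.inr (by simp [hx])
      · intro s
        rw [Wedge2.pair_of_left _ _ _ (by simpa using hrp)]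
        simp [hω]
      · intro x
        rw [Wedge2.pair_of_right _ _ _ (by simp)]
        rfl
      · intro x
        exact Wedge2.pair_congr (h' := h) _ _ _ rfl (by simp [show g (Wedge2.inl p 0 x) = x from rfl])
      · intro y
        simp [M]
      · intro y
        refine Eq.trans ?_ hf.symm
        simp [Whisker.tip]
      · intro y
        simp [M, Whisker.tip]
    exact (h1.trans h2).symm

/-- Independence of the base point. -/
theorem PtdEquiv.of_joined [T1Space X] {p q : X} (hp : ConicalAt p) (hq : ConicalAt q)
    (h : Joined p q) : PtdEquiv X p X q :=
  hp.ptdEquiv_whisker.trans ((Whisker.ptdEquiv_of_path h.somePath).trans hq.ptdEquiv_whisker.symm)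

end Whisker

/-! ### Points, maps and homotopies in realizations -/

namespace FaceComplex

variable {V : Type} [Fintype V] {Δ : FaceComplex V} {Z : Type} [TopologicalSpace Z]

theorem realization_nonneg (x : Δ.realization) (v : V) : 0 ≤ x.1 v := x.2.1.1 v

theorem realization_sum (x : Δ.realization) : ∑ v, x.1 v = 1 := x.2.1.2

theorem _root_.Continuous.coord {f : Z → Δ.realization} (hf : Continuous f) (v : V) :
    Continuous fun a => (f a).1 v :=
  (continuous_apply v).comp (continuous_subtype_val.comp hf)

theorem realization_le_one (x : Δ.realization) (v : V) : x.1 v ≤ 1 := by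
  rw [← realization_sum x]
  exact Finset.single_le_sum (fun u _ => realization_nonneg x u) (Finset.mem_univ v)

open Classical in
/-- The support of a function on the vertices. -/
def supp (x : V → ℝ) : Finset V := Finset.univ.filter fun v => x v ≠ 0

@[simp] theorem mem_supp {x : V → ℝ} {v : V} : v ∈ supp x ↔ x v ≠ 0 := by simp [supp]

theorem supp_mem_of_forall {x : V → ℝ} {s : Finset V} (hs : s ∈ Δ.faces) (h : ∀ v ∉ s, x v = 0) :
    supp x ∈ Δ.faces := by
  refine Δ.down_closed s hs _ fun v hv => ?_
  by_contra hvs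
  exact mem_supp.1 hv (h v hvs)

theorem supp_mem (x : Δ.realization) : supp x.1 ∈ Δ.faces := by
  obtain ⟨s, hs, h⟩ := x.2.2
  exact supp_mem_of_forall hs h

/-- The map into a realization given by homogeneous coordinates. -/
def homogeneousMap (Δ : FaceComplex V) (z : Z → V → ℝ) (hc : Continuous z) (h0 : ∀ a v, 0 ≤ z a v)
    (hpos : ∀ a, 0 < ∑ v, z a v) (hs : ∀ a, supp (z a) ∈ Δ.faces) : C(Z, Δ.realization) where
  toFun a := ⟨fun v => z a v / ∑ u, z a u, ⟨fun v => div_nonneg (h0 a v) (hpos a).le, by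
    rw [← Finset.sum_div, div_self (hpos a).ne']⟩, supp (z a), hs a, fun v hv => by
      have : z a v = 0 := by simpa using hv
      simp [this]⟩
  continuous_toFun := by
    refine Continuous.subtype_mk (continuous_pi fun v => ?_) _
    exact ((continuous_apply v).comp hc).div
      (continuous_finsetSum _ fun u _ => (continuous_apply u).comp hc) fun a => (hpos a).ne'

section

variable {z : Z → V → ℝ} {hc : Continuous z} {h0 : ∀ a v, 0 ≤ z a v}
  {hpos : ∀ a, 0 < ∑ v, z a v} {hs : ∀ a, supp (z a) ∈ Δ.faces}

theorem homogeneousMap_apply (a : Z) (v : V) :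
    (homogeneousMap Δ z hc h0 hpos hs a).1 v = z a v / ∑ u, z a u := rfl

theorem homogeneousMap_eq {a : Z} {x : Δ.realization} {c : ℝ} (hc0 : c ≠ 0)
    (h : ∀ v, z a v = c * x.1 v) : homogeneousMap Δ z hc h0 hpos hs a = x := by
  ext v
  rw [homogeneousMap_apply, h v]
  have : ∑ u, z a u = c := by
    rw [Finset.sum_congr rfl fun u _ => h u, ← Finset.mul_sum, realization_sum, mul_one]
  rw [this]
  field_simp

theorem homogeneousMap_eq_of_eq {a : Z} {x : Δ.realization} (h : ∀ v, z a v = x.1 v) :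
    homogeneousMap Δ z hc h0 hpos hs a = x :=
  homogeneousMap_eq one_ne_zero (by simpa using h)

end

/-- The straight line homotopy. -/
theorem homotopicRel_of_faces {f g : C(Z, Δ.realization)} {S : Set Z}
    (h : ∀ a, ∃ s ∈ Δ.faces, ∀ v ∉ s, (f a).1 v = 0 ∧ (g a).1 v = 0) (hS : ∀ a ∈ S, f a = g a) :
    f.HomotopicRel g S := by
  have hsum : ∀ (a : I × Z), ∑ v, ((1 - (a.1 : ℝ)) * (f a.2).1 v + a.1 * (g a.2).1 v) = 1 := by
    intro a
    rw [Finset.sum_add_distrib, ← Finset.mul_sum, ← Finset.mul_sum, realization_sum,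
      realization_sum]
    ring
  refine homotopicRel_of_function (homogeneousMap Δ
    (fun a : I × Z => fun v => (1 - (a.1 : ℝ)) * (f a.2).1 v + a.1 * (g a.2).1 v)
    ?_ ?_ ?_ ?_) (ContinuousMap.continuous _) ?_ ?_ ?_
  · refine continuous_pi fun v => ?_
    have h1 : Continuous fun a : I × Z => (f a.2).1 v :=
      (f.continuous.comp continuous_snd).coord v
    have h2 : Continuous fun a : I × Z => (g a.2).1 v :=
      (g.continuous.comp continuous_snd).coord v
    exact ((continuous_const.sub (by fun_prop)).mul h1).add (Continuous.mul (by fun_prop) h2)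
  · intro a v
    have h1 := realization_nonneg (f a.2) v
    have h2 := realization_nonneg (g a.2) v
    have h3 := a.1.2.1
    have h4 := sub_nonneg.2 a.1.2.2
    positivity
  · intro a
    rw [hsum]; norm_num
  · intro a
    obtain ⟨s, hs, h⟩ := h a.2
    refine supp_mem_of_forall hs fun v hv => ?_
    simp [h v hv]
  · intro a
    refine homogeneousMap_eq_of_eq ?_
    simp
  · intro a
    refine homogeneousMap_eq_of_eq ?_
    simp
  · intro s a ha
    refine homogeneousMap_eq_of_eq fun v => ?_
    rw [← hS a ha]
    ring

theorem joined_of_face {x y : Δ.realization} {s : Finset V} (hs : s ∈ Δ.faces)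
    (hx : ∀ v ∉ s, x.1 v = 0) (hy : ∀ v ∉ s, y.1 v = 0) : Joined x y := by
  obtain ⟨H⟩ := homotopicRel_of_faces (f := ContinuousMap.const Unit x)
    (g := ContinuousMap.const Unit y) (S := ∅) (fun _ => ⟨s, hs, fun v hv => ⟨hx v hv, hy v hv⟩⟩)
    (by simp)
  exact ⟨⟨⟨fun s => H (s, ()), by fun_prop⟩, by simp, by simp⟩⟩

/-- A point close to `p` has all vertices of the support of `p` in its own support, so its segment
to `p` stays in one face. Moving points along these segments, fully near `p` and not at all far
away, gives the deformation. -/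
theorem conicalAt (p : Δ.realization) : ConicalAt p := by
  obtain ⟨δ, hδ, hδp⟩ : ∃ δ > 0, ∀ v, p.1 v ≠ 0 → δ ≤ p.1 v := by
    obtain ⟨v, hv⟩ : (supp p.1).Nonempty := by
      by_contra h
      rw [Finset.not_nonempty_iff_eq_empty, Finset.eq_empty_iff_forall_notMem] at h
      have := realization_sum p
      rw [Finset.sum_eq_zero (fun v _ => by simpa using h v)] at this
      norm_num at this
    obtain ⟨u, hu, hmin⟩ := Finset.exists_min_image _ p.1 ⟨v, hv⟩
    exact ⟨p.1 u, lt_of_le_of_ne (realization_nonneg p u) (mem_supp.1 hu).symm,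
      fun v hv => hmin v (mem_supp.2 hv)⟩
  let m : Δ.realization → ℝ := fun x => 1 - dist x.1 p.1 / δ
  have hm : Continuous m := by fun_prop
  have hmp : m p = 1 := by simp [m]
  have hm1 : ∀ x, m x ≤ 1 := fun x => sub_le_self _ (by positivity)
  have hm0 : ∀ x, 0 < m x → ∀ v, p.1 v ≠ 0 → x.1 v ≠ 0 := by
    intro x hx v hv hxv
    have h1 : dist x.1 p.1 < δ := by
      have : dist x.1 p.1 / δ < 1 := by simpa [m] using hx
      rwa [div_lt_one hδ] at this
    have h2 := dist_le_pi_dist x.1 p.1 v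
    rw [hxv, Real.dist_eq, zero_sub, abs_neg, abs_of_nonneg (realization_nonneg p v)] at h2
    linarith [hδp v hv]
  -- The collapse is complete as soon as `m x ≥ 1/2`, while `ω = max 0 (2m - 1)` is nonzero only for
  -- `m x > 1/2`. So at every point `r x = p` or `ω x = 0`.
  let l : Δ.realization → ℝ := fun x => min 1 (max 0 (2 * m x))
  have hl : Continuous l := by fun_prop
  have hl0 : ∀ x, 0 ≤ l x := fun x => le_min zero_le_one (le_max_left _ _)
  have hl1 : ∀ x, l x ≤ 1 := fun x => min_le_left _ _
  have hlm : ∀ x, l x ≠ 0 → 0 < m x := by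
    intro x hx
    by_contra h
    exact hx (by simp [l, max_eq_left (show 2 * m x ≤ 0 by linarith)])
  have hsupp : ∀ x, ∀ v ∉ supp x.1, l x * p.1 v = 0 := by
    intro x v hv
    by_cases h : l x = 0
    · simp [h]
    · have := mt (hm0 x (hlm x h) v) (by simpa using hv)
      simp [not_not.1 this]
  let r : C(Δ.realization, Δ.realization) := homogeneousMap Δ
    (fun x v => (1 - l x) * x.1 v + l x * p.1 v)
    (continuous_pi fun v => ((continuous_const.sub hl).mul (continuous_id.coord v)).add
      (hl.mul continuous_const)) (by
      intro x v
      have h1 := realization_nonneg x v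
      have h2 := realization_nonneg p v
      have h3 := hl0 x
      have h4 := sub_nonneg.2 (hl1 x)
      positivity) (by
      intro x
      rw [Finset.sum_add_distrib, ← Finset.mul_sum, ← Finset.mul_sum, realization_sum,
        realization_sum]
      norm_num) (by
      intro x
      refine supp_mem_of_forall (supp_mem x) fun v hv => ?_
      rw [hsupp x v hv, show x.1 v = 0 by simpa using hv]
      simp)
  refine ⟨⟨fun x => ⟨max 0 (2 * m x - 1), le_max_left _ _, max_le zero_le_one (by linarith [hm1 x])⟩,
    by fun_prop⟩, r, ?_, ?_, ?_⟩
  · ext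
    simp [hmp]
    norm_num
  · refine homotopicRel_of_faces (fun x => ⟨supp x.1, supp_mem x, fun v hv => ?_⟩) ?_
    · have hv' : x.1 v = 0 := by simpa using hv
      refine ⟨hv', ?_⟩
      rw [homogeneousMap_apply, hsupp x v hv, hv']
      simp
    · rintro x rfl
      refine (homogeneousMap_eq_of_eq fun v => ?_).symm
      simp only [ContinuousMap.id_apply]
      ring
  · intro x
    rcases le_or_gt (2 * m x) 1 with h | h
    · refine Or.inr (Subtype.ext ?_)
      exact max_eq_left (by linarith)
    · refine Or.inl (homogeneousMap_eq_of_eq fun v => ?_)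
      have : l x = 1 := min_eq_left (h.le.trans (le_max_right _ _))
      rw [this]; ring

theorem ptdEquiv_basePoint [PathConnectedSpace Δ.realization] (p q : Δ.realization) :
    PtdEquiv Δ.realization p Δ.realization q :=
  PtdEquiv.of_joined (conicalAt p) (conicalAt q) (PathConnectedSpace.joined p q)

section

variable [DecidableEq V]

/-- A vertex as a point of the realization. -/
def vertexPt (v : V) (h : {v} ∈ Δ.faces) : Δ.realization :=
  ⟨Pi.single v 1, ⟨fun u => by
    by_cases hu : u = v
    · subst hu; simp
    · simp [hu], by simp⟩, {v}, h, fun u hu => by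
      simp [Finset.mem_singleton.not.1 hu]⟩

theorem vertexPt_apply (v : V) (h : {v} ∈ Δ.faces) (u : V) :
    (vertexPt v h).1 u = if u = v then 1 else 0 := by
  simp [vertexPt, Pi.single_apply]

/-- Cones are contractible. -/
theorem ptdEquiv_of_cone {v : V} (hv : {v} ∈ Δ.faces) (h : ∀ s ∈ Δ.faces, insert v s ∈ Δ.faces)
    {ι : Type} [IsEmpty ι] (X : ι → Type) [∀ i, TopologicalSpace (X i)] (p : ∀ i, X i) :
    PtdEquiv Δ.realization (vertexPt v hv) (Wedge X p) (Wedge.base X p) := by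
  refine ⟨ContinuousMap.const _ (Wedge.base X p), ContinuousMap.const _ (vertexPt v hv), rfl, rfl,
    ?_, ?_⟩
  · refine homotopicRel_of_faces (fun x => ⟨_, h _ (supp_mem x), fun u hu => ?_⟩) ?_
    · simp only [Finset.mem_insert, mem_supp, not_or, not_not] at hu
      simp [vertexPt_apply, hu]
    · rintro x rfl; rfl
  · convert ContinuousMap.HomotopicRel.refl _
    ext x
    induction x using Wedge.ind with
    | hb => rfl
    | hi i x => exact (IsEmpty.false i).elim

end

/-! ### Isomorphic complexes -/

/-- The faces of `Γ` are the images under `φ` of the faces of `Δ`. -/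
def IsImage {V W : Type} (φ : V ↪ W) (Δ : FaceComplex V) (Γ : FaceComplex W) : Prop :=
  Γ.faces = {s | ∃ r ∈ Δ.faces, s = r.map φ}

theorem IsImage.suspension {V W : Type} {φ : V ↪ W} {Δ : FaceComplex V} {Γ : FaceComplex W}
    (h : IsImage φ Δ Γ) :
    IsImage (φ.sumMap (Function.Embedding.refl Bool)) Δ.suspension Γ.suspension := by
  ext s
  constructor
  · rintro ⟨h1, h2⟩
    rw [h] at h1
    obtain ⟨r, hr, hrs⟩ := h1
    refine ⟨r.disjSum s.toRight, ⟨by simpa using hr, by simpa using h2⟩, ?_⟩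
    ext (x | b)
    · rw [← Finset.mem_toLeft, hrs]
      simp
    · simp
  · rintro ⟨r, ⟨h1, h2⟩, rfl⟩
    refine ⟨?_, ?_⟩
    · rw [h]
      refine ⟨_, h1, ?_⟩
      ext x
      simp
    · convert h2 using 1
      ext x
      simp

/-- Extension of coordinates by zero is inverse to restriction, because no face of `Γ` uses a vertex
outside the range of `φ`. -/
theorem IsImage.nonempty_homeomorph {V W : Type} [Fintype V] [Fintype W] {φ : V ↪ W}
    {Δ : FaceComplex V} {Γ : FaceComplex W} (h : IsImage φ Δ Γ) :
    Nonempty (Δ.realization ≃ₜ Γ.realization) := by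
  have hsum : ∀ x : V → ℝ, ∑ w, Function.extend φ x 0 w = ∑ v, x v := by
    intro x
    classical
    rw [← Finset.sum_subset (Finset.subset_univ (Finset.univ.map φ))]
    · rw [Finset.sum_map]
      exact Finset.sum_congr rfl fun v _ => φ.injective.extend_apply _ _ _
    · intro w _ hw
      exact Function.extend_apply' _ _ _ (by simpa using hw)
  have hz : ∀ y : Γ.realization, Function.extend φ (y.1 ∘ φ) 0 = y.1 := by
    intro y
    obtain ⟨s, hs, hsy⟩ := y.2.2
    rw [h] at hs
    obtain ⟨r, hr, rfl⟩ := hs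
    ext w
    by_cases hw : ∃ v, φ v = w
    · obtain ⟨v, rfl⟩ := hw
      simp [φ.injective.extend_apply]
    · rw [Function.extend_apply' _ _ _ hw, hsy w]
      · rfl
      · simp only [Finset.mem_map, not_exists, not_and]
        exact fun v _ hv => hw ⟨v, hv⟩
  refine ⟨⟨⟨fun x => ⟨Function.extend φ x.1 0, ⟨⟨fun w => ?_, ?_⟩, ?_⟩⟩,
    fun y => ⟨y.1 ∘ φ, ⟨⟨fun v => y.2.1.1 _, ?_⟩, ?_⟩⟩, ?_, ?_⟩, ?_, ?_⟩⟩
  · by_cases hw : ∃ v, φ v = w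
    · obtain ⟨v, rfl⟩ := hw
      rw [φ.injective.extend_apply]
      exact x.2.1.1 v
    · rw [Function.extend_apply' _ _ _ hw]
      rfl
  · rw [hsum, realization_sum]
  · obtain ⟨r, hr, hrx⟩ := x.2.2
    refine ⟨r.map φ, by rw [h]; exact ⟨r, hr, rfl⟩, fun w hw => ?_⟩
    by_cases hw' : ∃ v, φ v = w
    · obtain ⟨v, rfl⟩ := hw'
      rw [φ.injective.extend_apply]
      exact hrx v (by simpa using hw)
    · rw [Function.extend_apply' _ _ _ hw']
      rfl
  · rw [← hsum, hz, realization_sum]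
  · obtain ⟨s, hs, hsy⟩ := y.2.2
    rw [h] at hs
    obtain ⟨r, hr, rfl⟩ := hs
    exact ⟨r, hr, fun v hv => hsy _ (by simpa using hv)⟩
  · intro x
    ext v
    exact φ.injective.extend_apply _ _ _
  · intro y
    exact Subtype.ext (hz y)
  · refine Continuous.subtype_mk (continuous_pi fun w => ?_) _
    by_cases hw : ∃ v, φ v = w
    · obtain ⟨v, rfl⟩ := hw
      simp only [φ.injective.extend_apply]
      exact continuous_id.coord v
    · simp only [Function.extend_apply' _ _ _ hw]
      exact continuous_const
  · refine Continuous.subtype_mk (continuous_pi fun v => ?_) _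
    exact (continuous_apply _).comp continuous_subtype_val

/-- The embedding of iterated suspensions induced by an embedding of vertex sets. -/
def _root_.SquarefreePath.SuspVertex.map {V W : Type} (φ : V ↪ W) :
    (s : ℕ) → SuspVertex V s ↪ SuspVertex W s
  | 0 => φ
  | s + 1 => (SuspVertex.map φ s).sumMap (Function.Embedding.refl Bool)

theorem IsImage.iterSuspension {V W : Type} {φ : V ↪ W} {Δ : FaceComplex V} {Γ : FaceComplex W}
    (h : IsImage φ Δ Γ) (s : ℕ) :
    IsImage (SuspVertex.map φ s) (Δ.iterSuspension s) (Γ.iterSuspension s) := by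
  induction s with
  | zero => exact h
  | succ s ih => exact ih.suspension

/-! ### Suspensions -/

theorem mem_suspension {V : Type} {Δ : FaceComplex V} {s : Finset (V ⊕ Bool)} :
    s ∈ Δ.suspension.faces ↔ s.toLeft ∈ Δ.faces ∧ s.toRight.card ≤ 1 := Iff.rfl

theorem empty_mem_suspension {V : Type} {Δ : FaceComplex V} (h : ∅ ∈ Δ.faces) :
    ∅ ∈ Δ.suspension.faces :=
  mem_suspension.2 ⟨h, Nat.zero_le _⟩

theorem empty_mem_iterSuspension {V : Type} {Δ : FaceComplex V} (h : ∅ ∈ Δ.faces) (s : ℕ) :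
    ∅ ∈ (Δ.iterSuspension s).faces := by
  induction s with
  | zero => exact h
  | succ s ih => exact empty_mem_suspension ih

theorem singleton_inr_mem_suspension {V : Type} {Δ : FaceComplex V} (h : ∅ ∈ Δ.faces) (b : Bool) :
    {Sum.inr b} ∈ Δ.suspension.faces := by
  refine mem_suspension.2 ⟨?_, ?_⟩
  · convert h
    ext v
    simp
  · refine Finset.card_le_one.2 ?_
    simp

/-- Every point shares a face with one of the poles, and both poles are adjacent to `v`. -/
theorem pathConnectedSpace_suspension {v : V} (hv : {v} ∈ Δ.faces) :
    PathConnectedSpace Δ.suspension.realization := by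
  classical
  have h0 : ∅ ∈ Δ.faces := Δ.down_closed _ hv _ (Finset.empty_subset _)
  let P : Bool → Δ.suspension.realization := fun b =>
    vertexPt (Sum.inr b) (singleton_inr_mem_suspension h0 b)
  have hvs : ∀ b, {Sum.inl v, Sum.inr b} ∈ Δ.suspension.faces := by
    intro b
    refine mem_suspension.2 ⟨?_, ?_⟩
    · convert hv
      ext v
      simp
    · refine Finset.card_le_one.2 ?_
      simp
  let Q : Δ.suspension.realization := vertexPt (Sum.inl v)
    (Δ.suspension.down_closed _ (hvs true) _ (by simp))
  have hPQ : ∀ b, Joined (P b) Q := by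
    intro b
    refine joined_of_face (hvs b) ?_ ?_
    · intro u hu
      simp only [Finset.mem_insert, Finset.mem_singleton, not_or] at hu
      simp [P, vertexPt_apply, hu]
    · intro u hu
      simp only [Finset.mem_insert, Finset.mem_singleton, not_or] at hu
      simp [Q, vertexPt_apply, hu]
  have key : ∀ x : Δ.suspension.realization, ∃ b, Joined x (P b) := by
    intro x
    have hx := mem_suspension.1 (supp_mem x)
    obtain ⟨b, hb⟩ : ∃ b, (supp x.1).toRight ⊆ {b} := Finset.card_le_one_iff_subset_singleton.1 hx.2
    refine ⟨b, joined_of_face (s := insert (Sum.inr b) (supp x.1)) ?_ ?_ ?_⟩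
    · refine mem_suspension.2 ⟨?_, ?_⟩
      · convert hx.1 using 1
        ext u
        simp
      · refine Finset.card_le_one_iff_subset_singleton.2 ⟨b, ?_⟩
        intro c hc
        simp only [Finset.mem_toRight, Finset.mem_insert, Sum.inr.injEq] at hc
        rcases hc with rfl | hc
        · simp
        · exact hb (by simpa using hc)
    · intro u hu
      simp only [Finset.mem_insert, mem_supp, not_or, not_not] at hu
      exact hu.2
    · intro u hu
      simp only [Finset.mem_insert, mem_supp, not_or, not_not] at hu
      simp [P, vertexPt_apply, hu.1]
  refine ⟨⟨Q⟩, fun x y => ?_⟩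
  obtain ⟨b, hb⟩ := key x
  obtain ⟨c, hc⟩ := key y
  exact (hb.trans (hPQ b)).trans (hc.trans (hPQ c)).symm

end FaceComplex

/-! ### Splittings of complexes -/

namespace FaceComplex

open Classical in
/-- `Δ` is covered by `A` and a cone with apex `w`; these intersect in `C`, and inside `A` the
subcomplex `C` lies in a cone with apex `v`. -/
structure IsSplit {V : Type} (Δ A C : FaceComplex V) (w v : V) : Prop where
  le : A.faces ⊆ Δ.faces
  notMem : ∀ s ∈ A.faces, w ∉ s
  insert_mem : ∀ s ∈ Δ.faces, w ∉ s → s ∉ A.faces → insert w s ∈ Δ.faces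
  singleton_mem : {w} ∈ Δ.faces
  empty_mem : ∅ ∈ A.faces
  mem_iff : ∀ s, s ∈ C.faces ↔ s ∈ A.faces ∧ insert w s ∈ Δ.faces
  cone : ∀ s ∈ C.faces, insert v s ∈ A.faces

namespace IsSplit

theorem toLeft_insert {V : Type} {_ : DecidableEq V} {_ : DecidableEq (V ⊕ Bool)} (u : V)
    (s : Finset (V ⊕ Bool)) : (insert (Sum.inl u) s).toLeft = insert u s.toLeft := by
  ext; simp

theorem toRight_insert {V : Type} {_ : DecidableEq (V ⊕ Bool)} (u : V)
    (s : Finset (V ⊕ Bool)) : (insert (Sum.inl u) s).toRight = s.toRight := by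
  ext; simp

open Classical in
-- The conditions of a splitting never involve the two new poles, so the same apices work. This lets
-- the induction suspend complexes instead of homotopy equivalences.
theorem suspension {V : Type} {Δ A C : FaceComplex V} {w v : V} (h : IsSplit Δ A C w v) :
    IsSplit Δ.suspension A.suspension C.suspension (Sum.inl w) (Sum.inl v) := by
  refine ⟨?_, ?_, ?_, ?_, ?_, ?_, ?_⟩
  · rintro s ⟨h1, h2⟩
    exact ⟨h.le h1, h2⟩
  · rintro s ⟨h1, -⟩ hw
    exact h.notMem _ h1 (by simpa using hw)
  · rintro s ⟨h1, h2⟩ hw hA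
    refine mem_suspension.2 ⟨?_, by rwa [toRight_insert]⟩
    rw [toLeft_insert]
    exact h.insert_mem _ h1 (by simpa using hw) fun h3 => hA ⟨h3, h2⟩
  · refine mem_suspension.2 ⟨?_, ?_⟩
    · convert h.singleton_mem
      ext; simp
    · refine Finset.card_le_one.2 ?_
      simp
  · exact empty_mem_suspension h.empty_mem
  · intro s
    simp only [mem_suspension, toLeft_insert, toRight_insert, h.mem_iff]
    tauto
  · rintro s ⟨h1, h2⟩
    refine mem_suspension.2 ⟨?_, by rwa [toRight_insert]⟩
    rw [toLeft_insert]
    exact h.cone _ h1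

theorem iterSuspension {V : Type} {Δ A C : FaceComplex V} {w v : V} (h : IsSplit Δ A C w v)
    (s : ℕ) : ∃ w' v', IsSplit (Δ.iterSuspension s) (A.iterSuspension s) (C.iterSuspension s) w' v' := by
  induction s with
  | zero => exact ⟨w, v, h⟩
  | succ s ih =>
    obtain ⟨w', v', h'⟩ := ih
    exact ⟨_, _, h'.suspension⟩

variable {V : Type} {Δ A C : FaceComplex V} {w v : V}

theorem empty_mem_right (h : IsSplit Δ A C w v) : ∅ ∈ C.faces := by
  rw [h.mem_iff]
  exact ⟨h.empty_mem, by simpa using h.singleton_mem⟩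

theorem vertex_mem (h : IsSplit Δ A C w v) : {v} ∈ A.faces := by
  simpa using h.cone _ h.empty_mem_right

theorem ne (h : IsSplit Δ A C w v) : v ≠ w := by
  rintro rfl
  exact h.notMem _ h.vertex_mem (by simp)

open Classical in
/-- The union of `A` and the cone with apex `w` over `C`. -/
def core (Δ A : FaceComplex V) (w : V) : FaceComplex V where
  faces := {s | s ∈ Δ.faces ∧ s.erase w ∈ A.faces}
  down_closed := fun s hs r hr =>
    ⟨Δ.down_closed s hs.1 r hr, A.down_closed _ hs.2 _ (Finset.erase_subset_erase w hr)⟩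

/-- Passing to the core keeps `A`, `C` and both apices. What is gained is that all faces avoiding
`w` now lie in `A`, which the pinch map needs. -/
theorem core_isSplit (h : IsSplit Δ A C w v) : IsSplit (core Δ A w) A C w v := by
  classical
  have he : ∀ s ∈ A.faces, s.erase w ∈ A.faces := fun s hs =>
    A.down_closed s hs _ (Finset.erase_subset _ _)
  refine ⟨fun s hs => ⟨h.le hs, he s hs⟩, h.notMem, ?_, ⟨h.singleton_mem, ?_⟩,
    h.empty_mem, ?_, h.cone⟩
  · rintro s ⟨h1, h2⟩ hw hA
    rw [Finset.erase_eq_of_notMem hw] at h2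
    exact absurd h2 hA
  · convert h.empty_mem
    ext; simp
  · intro s
    rw [h.mem_iff]
    refine and_congr_right fun hs => ⟨fun h1 => ⟨by convert h1, ?_⟩, fun h1 => by convert h1.1⟩
    convert hs
    ext u
    by_cases hu : u = w
    · subst hu
      simp [h.notMem s hs]
    · simp [hu]

/-- The deformation retraction onto the core. -/
theorem ptdEquiv_core [Fintype V] (h : IsSplit Δ A C w v) (p : (core Δ A w).realization) :
    ∃ q : Δ.realization, PtdEquiv Δ.realization q (core Δ A w).realization p := by
  classical
  -- `M G x` is the largest coordinate of `x` outside `G ∪ {w}`. Its minimum `θ x` over the faces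
  -- `G` of `A` measures how far `x` is from the core.
  let M : Finset V → Δ.realization → ℝ := fun G x =>
    Finset.univ.sup' ⟨w, Finset.mem_univ w⟩ fun u => if u ∈ G ∨ u = w then 0 else x.1 u
  have hMc : ∀ G, Continuous (M G) := by
    intro G
    refine Continuous.finset_sup'_apply _ fun u _ => ?_
    split_ifs
    · exact continuous_const
    · exact continuous_id.coord u
  have hM0 : ∀ G x, 0 ≤ M G x := by
    intro G x
    have := Finset.le_sup' (fun u => if u ∈ G ∨ u = w then 0 else x.1 u) (Finset.mem_univ w)
    simpa using this
  have hne : (Finset.univ.filter fun G => G ∈ A.faces).Nonempty :=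
    ⟨∅, by simpa using h.empty_mem⟩
  let θ : Δ.realization → ℝ := fun x =>
    (Finset.univ.filter fun G => G ∈ A.faces).inf' hne fun G => M G x
  have hθc : Continuous θ := Continuous.finset_inf'_apply _ fun G _ => hMc G
  have hθ : ∀ x, 0 ≤ θ x ∧ ∃ G ∈ A.faces, ∀ u ∉ G, u ≠ w → x.1 u ≤ θ x := by
    intro x
    obtain ⟨G, hG, hGx⟩ := Finset.exists_mem_eq_inf' hne fun G => M G x
    have hθG : θ x = M G x := hGx
    refine ⟨hθG ▸ hM0 G x, G, by simpa using hG, fun u hu huw => ?_⟩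
    rw [hθG]
    have := Finset.le_sup' (fun u => if u ∈ G ∨ u = w then 0 else x.1 u) (Finset.mem_univ u)
    simpa [hu, huw] using this
  have hθ0 : ∀ x, (supp x.1).erase w ∈ A.faces → θ x = 0 := by
    intro x hx
    refine le_antisymm ?_ (hθ x).1
    refine (Finset.inf'_le _ (by simpa using hx)).trans ?_
    refine Finset.sup'_le _ _ fun u _ => ?_
    split_ifs with hu
    · exact le_rfl
    · simp only [Finset.mem_erase, mem_supp] at hu
      have : x.1 u = 0 := by tauto
      exact this.le
  -- Each coordinate other than `w` is lowered by `θ x`, which kills everything outside a minimizing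
  -- face of `A`. The mass cut off goes to `w`; the summand at `w` itself only increases that
  -- weight, and normalization absorbs it.
  let z : Δ.realization → V → ℝ := fun x u =>
    if u = w then x.1 w + ∑ u', min (x.1 u') (θ x) else max 0 (x.1 u - θ x)
  have hz0 : ∀ x u, 0 ≤ z x u := by
    intro x u
    simp only [z]
    split_ifs
    · exact add_nonneg (realization_nonneg x w)
        (Finset.sum_nonneg fun u' _ => le_min (realization_nonneg x u') (hθ x).1)
    · exact le_max_left _ _
  have hzx : ∀ x, θ x = 0 → z x = x.1 := by
    intro x hx
    ext u
    have hmin : ∀ u', min (x.1 u') 0 = 0 := fun u' => min_eq_right (realization_nonneg x u')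
    simp only [z, hx, hmin]
    split_ifs with hu
    · simp [hu]
    · simpa using realization_nonneg x u
  have hzw : ∀ x, supp (z x) ⊆ insert w (supp x.1) := by
    intro x u hu
    rw [mem_supp] at hu
    by_cases huw : u = w
    · simp [huw]
    · refine Finset.mem_insert_of_mem (mem_supp.2 fun hxu => hu ?_)
      simp [z, huw, hxu, (hθ x).1]
  -- If `θ x ≠ 0`, the support of `x` minus `w` is not in `A`, so `w` may be added to the support.
  -- This makes the straight line homotopy to the retraction legitimate.
  have hface : ∀ x, ∃ s ∈ Δ.faces, supp x.1 ⊆ s ∧ supp (z x) ⊆ s := by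
    intro x
    by_cases hx : θ x = 0
    · exact ⟨supp x.1, supp_mem x, subset_rfl, by rw [hzx x hx]⟩
    · refine ⟨insert w (supp x.1), ?_, Finset.subset_insert _ _, hzw x⟩
      by_cases hw : w ∈ supp x.1
      · rw [Finset.insert_eq_of_mem hw]
        exact supp_mem x
      · have := h.insert_mem _ (supp_mem x) hw fun hA => hx (hθ0 x (by
          rwa [Finset.erase_eq_of_notMem hw]))
        convert this
  have hzpos : ∀ x, 0 < ∑ u, z x u := by
    intro x
    obtain ⟨u, -, hu⟩ : ∃ u ∈ Finset.univ, x.1 u ≠ 0 := by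
      refine Finset.exists_ne_zero_of_sum_ne_zero ?_
      rw [realization_sum]
      exact one_ne_zero
    have hu' := lt_of_le_of_ne (realization_nonneg x u) hu.symm
    refine Finset.sum_pos' (fun u _ => hz0 x u) ?_
    by_cases hx : θ x = 0
    · exact ⟨u, Finset.mem_univ u, by rwa [hzx x hx]⟩
    · refine ⟨w, Finset.mem_univ w, ?_⟩
      have : 0 < ∑ u', min (x.1 u') (θ x) :=
        Finset.sum_pos' (fun u' _ => le_min (realization_nonneg x u') (hθ x).1)
          ⟨u, Finset.mem_univ u, lt_min hu' (lt_of_le_of_ne (hθ x).1 (Ne.symm hx))⟩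
      simpa [z] using add_pos_of_nonneg_of_pos (realization_nonneg x w) this
  have hzc : Continuous z := by
    refine continuous_pi fun u => ?_
    simp only [z]
    split_ifs
    · exact (continuous_id.coord w).add
        (continuous_finsetSum _ fun u' _ => (continuous_id.coord u').min hθc)
    · exact continuous_const.max ((continuous_id.coord u).sub hθc)
  let r : C(Δ.realization, (core Δ A w).realization) :=
    homogeneousMap _ z hzc hz0 hzpos (by
      intro x
      obtain ⟨s, hs, -, hs'⟩ := hface x
      refine ⟨Δ.down_closed s hs _ hs', ?_⟩
      obtain ⟨hx0, G, hG, hGx⟩ := hθ x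
      refine A.down_closed G hG _ fun u hu => ?_
      by_contra huG
      simp only [Finset.mem_erase, mem_supp, z] at hu
      have := hGx u huG hu.1
      simp [hu.1, this] at hu)
  let j : C((core Δ A w).realization, Δ.realization) :=
    ⟨fun x => ⟨x.1, x.2.1, supp x.1, (supp_mem x).1, by simp⟩, by fun_prop⟩
  have hrj : ∀ x, r (j x) = x := by
    intro x
    refine homogeneousMap_eq_of_eq fun u => ?_
    rw [hzx (j x) (hθ0 _ (by
      change (supp x.1).erase w ∈ A.faces
      convert (supp_mem x).2))]
    rfl
  refine ⟨j p, r, j, hrj p, rfl, ?_, ?_⟩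
  · refine homotopicRel_of_faces (fun x => ?_) ?_
    · obtain ⟨s, hs, h1, h2⟩ := hface x
      refine ⟨s, hs, fun u hu => ⟨?_, ?_⟩⟩
      · have : z x u = 0 := by simpa using mt (@h2 u) hu
        change z x u / _ = 0
        rw [this, zero_div]
      · simpa using mt (@h1 u) hu
    · rintro x rfl
      exact congrArg j (hrj p)
  · convert ContinuousMap.HomotopicRel.refl _
    ext1 x
    exact (hrj x).symm

end IsSplit

end FaceComplex

/-! ### The pinch map from the core to the wedge, and its inverse -/

namespace FaceComplex

section

variable {V : Type} [Fintype V] {Δ : FaceComplex V} {Z Z' : Type} [TopologicalSpace Z]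
  [TopologicalSpace Z']

theorem exists_mul_coord {z : Z → V → ℝ} {hc : Continuous z} {h0 : ∀ a v, 0 ≤ z a v}
    {hpos : ∀ a, 0 < ∑ v, z a v} {hs : ∀ a, supp (z a) ∈ Δ.faces} {f : C(Z, Δ.realization)}
    (hf : f = homogeneousMap Δ z hc h0 hpos hs) (a : Z) :
    ∃ N : ℝ, N ≠ 0 ∧ ∀ u, N * (f a).1 u = z a u :=
  ⟨∑ v, z a v, (hpos a).ne', fun u => by
    rw [hf, homogeneousMap_apply, mul_div_cancel₀ _ (hpos a).ne']⟩

theorem homogeneousMap_val_congr {Γ : FaceComplex V} {z : Z → V → ℝ} {hc : Continuous z}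
    {h0 : ∀ a v, 0 ≤ z a v} {hpos : ∀ a, 0 < ∑ v, z a v} {hs : ∀ a, supp (z a) ∈ Δ.faces}
    {z' : Z' → V → ℝ} {hc' : Continuous z'} {h0' : ∀ a v, 0 ≤ z' a v}
    {hpos' : ∀ a, 0 < ∑ v, z' a v} {hs' : ∀ a, supp (z' a) ∈ Γ.faces} {a : Z} {a' : Z'}
    (h : ∀ v, z a v = z' a' v) :
    (homogeneousMap Δ z hc h0 hpos hs a).1 = (homogeneousMap Γ z' hc' h0' hpos' hs' a').1 := by
  have : z a = z' a' := funext h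
  ext v
  simp only [homogeneousMap_apply, this]

theorem homogeneousMap_congr {z : Z → V → ℝ} {hc : Continuous z} {h0 : ∀ a v, 0 ≤ z a v}
    {hpos : ∀ a, 0 < ∑ v, z a v} {hs : ∀ a, supp (z a) ∈ Δ.faces}
    {z' : Z' → V → ℝ} {hc' : Continuous z'} {h0' : ∀ a v, 0 ≤ z' a v}
    {hpos' : ∀ a, 0 < ∑ v, z' a v} {hs' : ∀ a, supp (z' a) ∈ Δ.faces} {a : Z} {a' : Z'}
    (h : ∀ v, z a v = z' a' v) :
    homogeneousMap Δ z hc h0 hpos hs a = homogeneousMap Δ z' hc' h0' hpos' hs' a' :=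
  Subtype.ext (homogeneousMap_val_congr h)

end

namespace IsSplit

variable {V : Type} {Δ A C : FaceComplex V} {w v : V} {Z : Type} [TopologicalSpace Z]

open Classical in
/-- The coordinates away from `w`. -/
def off (w : V) (x : V → ℝ) (u : V) : ℝ := if u = w then 0 else x u

theorem off_self (x : V → ℝ) : off w x w = 0 := if_pos rfl

theorem off_of_ne {x : V → ℝ} {u : V} (hu : u ≠ w) : off w x u = x u := if_neg hu

variable [Fintype V]

open Classical in
/-- The map into `A` with homogeneous coordinates `a • y + b • v`. -/
def toA (h : IsSplit Δ A C w v) (y : Z → V → ℝ) (a b : Z → ℝ) (hy : Continuous y)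
    (ha : Continuous a) (hb : Continuous b) (hy0 : ∀ z u, 0 ≤ y z u) (ha0 : ∀ z, 0 ≤ a z)
    (hb0 : ∀ z, 0 ≤ b z) (hpos : ∀ z, 0 < a z * ∑ u, y z u + b z)
    (hs : ∀ z, supp (y z) ∈ C.faces ∨ b z = 0 ∧ supp (y z) ∈ A.faces) : C(Z, A.realization) :=
  homogeneousMap A (fun z u => a z * y z u + if u = v then b z else 0)
    (continuous_pi fun u => (ha.mul ((continuous_apply u).comp hy)).add
      (by split_ifs; exacts [hb, continuous_const]))
    (fun z u => add_nonneg (mul_nonneg (ha0 z) (hy0 z u)) (by split_ifs; exacts [hb0 z, le_rfl]))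
    (fun z => by
      rw [Finset.sum_add_distrib, ← Finset.mul_sum, Finset.sum_ite_eq' Finset.univ v]
      simpa using hpos z)
    (fun z => by
      rcases hs z with h1 | ⟨h1, h2⟩
      · refine supp_mem_of_forall (h.cone _ h1) fun u hu => ?_
        simp only [Finset.mem_insert, mem_supp, not_or, not_not] at hu
        simp [hu]
      · refine supp_mem_of_forall h2 fun u hu => ?_
        have hu' : y z u = 0 := by simpa using hu
        simp [h1, hu'])

/-- The map into the suspension of `C` with homogeneous coordinates `a • y` and the weights `F` and
`T` at the two poles. -/
def toSusp (h : IsSplit Δ A C w v) (y : Z → V → ℝ) (a F T : Z → ℝ) (hy : Continuous y)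
    (ha : Continuous a) (hF : Continuous F) (hT : Continuous T) (hy0 : ∀ z u, 0 ≤ y z u)
    (ha0 : ∀ z, 0 ≤ a z) (hF0 : ∀ z, 0 ≤ F z) (hT0 : ∀ z, 0 ≤ T z)
    (hpos : ∀ z, 0 < a z * ∑ u, y z u + (F z + T z)) (hFT : ∀ z, F z = 0 ∨ T z = 0)
    (hs : ∀ z, supp (y z) ∈ C.faces ∨ a z = 0) : C(Z, C.suspension.realization) :=
  homogeneousMap C.suspension
    (fun z => Sum.elim (fun u => a z * y z u) (fun i => bif i then T z else F z))
    (continuous_pi fun u => by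
      rcases u with u | (_ | _)
      · exact ha.mul ((continuous_apply u).comp hy)
      · exact hF
      · exact hT)
    (fun z u => by
      rcases u with u | (_ | _)
      · exact mul_nonneg (ha0 z) (hy0 z u)
      · exact hF0 z
      · exact hT0 z)
    (fun z => by
      rw [Fintype.sum_sum_type]
      simp only [Sum.elim_inl, Sum.elim_inr, Fintype.sum_bool, cond_true, cond_false]
      rw [← Finset.mul_sum, add_comm (T z)]
      exact hpos z)
    (fun z => by
      refine mem_suspension.2 ⟨?_, ?_⟩
      · rcases hs z with h1 | h1
        · refine C.down_closed _ h1 _ fun u hu => ?_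
          rw [Finset.mem_toLeft, mem_supp] at hu
          exact mem_supp.2 (right_ne_zero_of_mul hu)
        · convert h.empty_mem_right
          ext u
          simp [h1]
      · refine Finset.card_le_one.2 ?_
        rintro (_ | _) hb (_ | _) hc
        · rfl
        · simp only [Finset.mem_toRight, mem_supp, Sum.elim_inr, cond_true, cond_false] at hb hc
          have := hFT z
          tauto
        · simp only [Finset.mem_toRight, mem_supp, Sum.elim_inr, cond_true, cond_false] at hb hc
          have := hFT z
          tauto
        · rfl)

open Classical in
/-- The map into `Δ` with homogeneous coordinates `a • y + b • v + c • w`. -/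
def toTotal (h : IsSplit Δ A C w v) (y : Z → V → ℝ) (a b c : Z → ℝ) (hy : Continuous y)
    (ha : Continuous a) (hb : Continuous b) (hc : Continuous c) (hy0 : ∀ z u, 0 ≤ y z u)
    (ha0 : ∀ z, 0 ≤ a z) (hb0 : ∀ z, 0 ≤ b z) (hc0 : ∀ z, 0 ≤ c z)
    (hpos : ∀ z, 0 < a z * ∑ u, y z u + b z + c z) (hbc : ∀ z, b z = 0 ∨ c z = 0)
    (hs : ∀ z, supp (y z) ∈ C.faces ∨ b z = 0 ∧ c z = 0 ∧ supp (y z) ∈ A.faces) :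
    C(Z, Δ.realization) :=
  homogeneousMap Δ
    (fun z u => a z * y z u + (if u = v then b z else 0) + if u = w then c z else 0)
    (continuous_pi fun u => ((ha.mul ((continuous_apply u).comp hy)).add
      (by split_ifs; exacts [hb, continuous_const])).add
      (by split_ifs; exacts [hc, continuous_const]))
    (fun z u => add_nonneg (add_nonneg (mul_nonneg (ha0 z) (hy0 z u))
      (by split_ifs; exacts [hb0 z, le_rfl])) (by split_ifs; exacts [hc0 z, le_rfl]))
    (fun z => by
      rw [Finset.sum_add_distrib, Finset.sum_add_distrib, ← Finset.mul_sum,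
        Finset.sum_ite_eq' Finset.univ v, Finset.sum_ite_eq' Finset.univ w]
      simpa using hpos z)
    (fun z => by
      rcases hs z with h1 | ⟨h1, h2, h3⟩
      · rcases hbc z with h2 | h2
        · refine supp_mem_of_forall ((h.mem_iff _).1 h1).2 fun u hu => ?_
          simp only [Finset.mem_insert, mem_supp, not_or, not_not] at hu
          simp [hu, h2]
        · refine supp_mem_of_forall (h.le (h.cone _ h1)) fun u hu => ?_
          simp only [Finset.mem_insert, mem_supp, not_or, not_not] at hu
          simp [hu, h2]
      · refine supp_mem_of_forall (h.le h3) fun u hu => ?_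
        have hu' : y z u = 0 := by simpa using hu
        simp [h1, h2, hu'])

theorem sum_off (x : Δ.realization) : ∑ u, off w x.1 u = 1 - x.1 w := by
  classical
  rw [← realization_sum x, ← Finset.sum_erase_add _ _ (Finset.mem_univ w),
    ← Finset.sum_erase_add Finset.univ x.1 (Finset.mem_univ w), off_self]
  rw [Finset.sum_congr rfl fun u hu => off_of_ne (Finset.ne_of_mem_erase hu)]
  ring

theorem off_nonneg (x : Δ.realization) (u : V) : 0 ≤ off w x.1 u := by
  unfold off
  split_ifs
  exacts [le_rfl, realization_nonneg x u]

theorem continuous_off : Continuous fun x : Δ.realization => off w x.1 := by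
  refine continuous_pi fun u => ?_
  unfold off
  split_ifs
  exacts [continuous_const, continuous_id.coord u]

theorem supp_off (hL : ∀ s ∈ Δ.faces, w ∉ s → s ∈ A.faces) (x : Δ.realization) :
    supp (off w x.1) ∈ A.faces := by
  refine hL _ (Δ.down_closed _ (supp_mem x) _ fun u hu => ?_) (by simp [off])
  by_cases huw : u = w
  · subst huw; simp [off] at hu
  · simpa [off, huw] using hu

theorem supp_off' (h : IsSplit Δ A C w v) (hL : ∀ s ∈ Δ.faces, w ∉ s → s ∈ A.faces)
    (x : Δ.realization) (hx : x.1 w ≠ 0) : supp (off w x.1) ∈ C.faces := by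
  rw [h.mem_iff]
  refine ⟨supp_off hL x, ?_⟩
  convert supp_mem x
  ext u
  by_cases huw : u = w
  · subst huw; simpa using hx
  · simp [huw, off_of_ne huw]

section Maps

variable (h : IsSplit Δ A C w v) (hL : ∀ s ∈ Δ.faces, w ∉ s → s ∈ A.faces)

theorem coord_mem (x : Δ.realization) (u : V) : 0 ≤ x.1 u ∧ x.1 u ≤ 1 :=
  ⟨realization_nonneg x u, realization_le_one x u⟩

theorem supp_off_cases (h : IsSplit Δ A C w v) (hL : ∀ s ∈ Δ.faces, w ∉ s → s ∈ A.faces)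
    (x : Δ.realization) :
    supp (off w x.1) ∈ C.faces ∨ x.1 w = 0 ∧ supp (off w x.1) ∈ A.faces := by
  by_cases hx : x.1 w = 0
  · exact Or.inr ⟨hx, supp_off hL x⟩
  · exact Or.inl (h.supp_off' hL x hx)

/-- The component in `A` of the pinch map. -/
def pinchA : C(Δ.realization, A.realization) :=
  -- The lower half of the cone over `C` is sent through the cone with apex `v` in `A`: the identity
  -- at height `x w = 0`, the vertex `v` from height `1/2` on.
  h.toA (fun x => off w x.1) (fun x => max 0 (1 - 2 * x.1 w)) (fun x => x.1 w / 2) continuous_off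
    (continuous_const.max (continuous_const.sub (continuous_const.mul (continuous_id.coord w))))
    ((continuous_id.coord w).div_const 2) off_nonneg (fun _ => le_max_left _ _)
    (fun x => by linarith [(coord_mem x w).1])
    (fun x => by
      rw [sum_off]
      have := coord_mem x w
      rcases this.1.eq_or_lt with h0 | h0
      · rw [← h0]; norm_num
      · have : 0 ≤ max 0 (1 - 2 * x.1 w) * (1 - x.1 w) :=
          mul_nonneg (le_max_left _ _) (by linarith)
        linarith)
    (fun x => (supp_off_cases h hL x).imp id (fun h => ⟨by simp [h.1], h.2⟩))

/-- The component in the suspension of `C` of the pinch map. -/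
def pinchSusp : C(Δ.realization, C.suspension.realization) :=
  -- The upper half becomes the suspension: up to height `1/2` only the pole `false` has weight, at
  -- height `1` only the pole `true`. The value `3/4`, midway, is where the pole weight changes
  -- sides.
  h.toSusp (fun x => off w x.1) (fun x => max 0 (2 * x.1 w - 1)) (fun x => max 0 (3 / 4 - x.1 w))
    (fun x => max 0 (x.1 w - 3 / 4)) continuous_off
    (continuous_const.max ((continuous_const.mul (continuous_id.coord w)).sub continuous_const))
    (continuous_const.max (continuous_const.sub (continuous_id.coord w)))
    (continuous_const.max ((continuous_id.coord w).sub continuous_const))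
    off_nonneg (fun _ => le_max_left _ _) (fun _ => le_max_left _ _) (fun _ => le_max_left _ _)
    (fun x => by
      rw [sum_off]
      have := coord_mem x w
      have h1 : 0 ≤ max 0 (2 * x.1 w - 1) * (1 - x.1 w) :=
        mul_nonneg (le_max_left _ _) (by linarith)
      rcases lt_trichotomy (x.1 w) (3 / 4) with h0 | h0 | h0
      · have := le_max_right 0 (3 / 4 - x.1 w)
        have := le_max_left 0 (x.1 w - 3 / 4)
        linarith
      · rw [h0]; norm_num
      · have := le_max_right 0 (x.1 w - 3 / 4)
        have := le_max_left 0 (3 / 4 - x.1 w)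
        linarith)
    (fun x => by
      rcases le_total (x.1 w) (3 / 4) with h0 | h0
      · exact Or.inr (max_eq_left (by linarith))
      · exact Or.inl (max_eq_left (by linarith)))
    (fun x => (supp_off_cases h hL x).imp id (fun h => by rw [h.1]; norm_num))

theorem susp_sum (y : C.suspension.realization) :
    ∑ u, y.1 (Sum.inl u) = 1 - y.1 (Sum.inr false) - y.1 (Sum.inr true) := by
  have := realization_sum y
  rw [Fintype.sum_sum_type, Fintype.sum_bool] at this
  linarith

theorem susp_poles (y : C.suspension.realization) :
    y.1 (Sum.inr false) = 0 ∨ y.1 (Sum.inr true) = 0 := by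
  by_contra! hy
  have := Finset.card_le_one.1 (mem_suspension.1 (supp_mem y)).2 false (by simpa using hy.1) true
    (by simpa using hy.2)
  cases this

theorem susp_supp (y : C.suspension.realization) :
    supp (fun u => y.1 (Sum.inl u)) ∈ C.faces := by
  convert (mem_suspension.1 (supp_mem y)).1
  ext u
  simp

theorem continuous_susp : Continuous fun (y : C.suspension.realization) u => y.1 (Sum.inl u) :=
  continuous_pi fun _ => continuous_id.coord _

/-- The map from the suspension of `C` which sends the poles to `v` and `w`. -/
def unpinch : C(C.suspension.realization, Δ.realization) :=
  h.toTotal (fun y u => y.1 (Sum.inl u)) (fun _ => 1) (fun y => y.1 (Sum.inr false))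
    (fun y => y.1 (Sum.inr true)) continuous_susp continuous_const (continuous_id.coord _)
    (continuous_id.coord _) (fun y _ => realization_nonneg y _) (fun _ => zero_le_one)
    (fun y => realization_nonneg y _) (fun y => realization_nonneg y _)
    (fun y => by rw [susp_sum]; linarith) susp_poles (fun y => Or.inl (susp_supp y))

open Classical in
theorem unpinch_apply (y : C.suspension.realization) (u : V) :
    (h.unpinch y).1 u = y.1 (Sum.inl u) + (if u = v then y.1 (Sum.inr false) else 0) +
      if u = w then y.1 (Sum.inr true) else 0 := by
  unfold unpinch toTotal
  rw [homogeneousMap_apply]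
  have : ∑ u, (1 * y.1 (Sum.inl u) + (if u = v then y.1 (Sum.inr false) else 0) +
      if u = w then y.1 (Sum.inr true) else 0) = 1 := by
    rw [Finset.sum_add_distrib, Finset.sum_add_distrib, ← Finset.mul_sum,
      Finset.sum_ite_eq' Finset.univ v, Finset.sum_ite_eq' Finset.univ w, susp_sum]
    simp only [Finset.mem_univ, if_true]
    ring
  rw [this]
  simp

theorem susp_apply_apex (h : IsSplit Δ A C w v) (y : C.suspension.realization) :
    y.1 (Sum.inl w) = 0 := by
  by_contra hy
  exact h.notMem _ ((h.mem_iff _).1 (susp_supp y)).1 (mem_supp.2 hy)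

/-- The inclusion of `A`. -/
def inclA : C(A.realization, Δ.realization) :=
  ⟨fun x => ⟨x.1, x.2.1, supp x.1, h.le (supp_mem x), by simp⟩, by fun_prop⟩

theorem apply_apex (h : IsSplit Δ A C w v) (x : A.realization) : x.1 w = 0 := by
  by_contra hx
  exact h.notMem _ (supp_mem x) (mem_supp.2 hx)

open Classical in
/-- The vertex `v` in `A`. -/
def baseA : A.realization := vertexPt v h.vertex_mem

open Classical in
/-- A pole of the suspension. -/
def pole : C.suspension.realization :=
  vertexPt (Sum.inr false) (singleton_inr_mem_suspension h.empty_mem_right false)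

theorem pinchSusp_eq_pole {x : Δ.realization} (hx : x.1 w ≤ 1 / 2) :
    h.pinchSusp hL x = h.pole := by
  classical
  unfold pinchSusp toSusp
  refine homogeneousMap_eq (c := 3 / 4 - x.1 w) (by linarith) ?_
  have h1 : max 0 (2 * x.1 w - 1) = 0 := max_eq_left (by linarith)
  have h2 : max 0 (3 / 4 - x.1 w) = 3 / 4 - x.1 w := max_eq_right (by linarith)
  have h3 : max 0 (x.1 w - 3 / 4) = 0 := max_eq_left (by linarith)
  rintro (u | (_ | _))
  · simp [h1, pole, vertexPt_apply]
  · simp [h2, pole, vertexPt_apply]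
  · simp [h3, pole, vertexPt_apply]

theorem pinchA_eq_base {x : Δ.realization} (hx : 1 / 2 ≤ x.1 w) : h.pinchA hL x = h.baseA := by
  classical
  unfold pinchA toA
  refine homogeneousMap_eq (c := x.1 w / 2) (by linarith) fun u => ?_
  have h1 : max 0 (1 - 2 * x.1 w) = 0 := max_eq_left (by linarith)
  simp [h1, baseA, vertexPt_apply]

theorem pinch_cases (x : Δ.realization) : h.pinchA hL x = h.baseA ∨ h.pinchSusp hL x = h.pole :=
  (le_total (x.1 w) (1 / 2)).symm.imp (h.pinchA_eq_base hL) (h.pinchSusp_eq_pole hL)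

theorem exists_pinchSusp_coord (x : Δ.realization) : ∃ N : ℝ, N ≠ 0 ∧
    (∀ u, N * (h.pinchSusp hL x).1 (Sum.inl u) = max 0 (2 * x.1 w - 1) * off w x.1 u) ∧
    N * (h.pinchSusp hL x).1 (Sum.inr false) = max 0 (3 / 4 - x.1 w) ∧
    N * (h.pinchSusp hL x).1 (Sum.inr true) = max 0 (x.1 w - 3 / 4) := by
  have key : ∃ N : ℝ, N ≠ 0 ∧ ∀ u, N * (h.pinchSusp hL x).1 u =
      Sum.elim (fun u => max 0 (2 * x.1 w - 1) * off w x.1 u)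
        (fun i => bif i then max 0 (x.1 w - 3 / 4) else max 0 (3 / 4 - x.1 w)) u := by
    unfold pinchSusp toSusp
    exact exists_mul_coord rfl x
  obtain ⟨N, h1, h2⟩ := key
  exact ⟨N, h1, fun u => h2 (Sum.inl u), h2 (Sum.inr false), h2 (Sum.inr true)⟩

/-- The pinch map. -/
def pinch : C(Δ.realization, Wedge2 A.realization h.baseA C.suspension.realization h.pole) :=
  Wedge2.pair _ _ (h.pinchA hL) (h.pinchSusp hL) (h.pinch_cases hL)

theorem inclA_base : h.inclA h.baseA = h.unpinch h.pole := by
  classical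
  ext u
  rw [unpinch_apply]
  simp [inclA, baseA, pole, vertexPt_apply]

/-- The inverse of the pinch map. -/
def unpinchMap :
    C(Wedge2 A.realization h.baseA C.suspension.realization h.pole, Δ.realization) :=
  Wedge2.lift h.inclA h.unpinch h.inclA_base

theorem pinchA_inclA (x : A.realization) : h.pinchA hL (h.inclA x) = x := by
  have hx : (h.inclA x).1 w = 0 := h.apply_apex x
  unfold pinchA toA
  refine homogeneousMap_eq_of_eq fun u => ?_
  simp only [hx]
  by_cases hu : u = w
  · subst hu
    simp [off_self, h.apply_apex x]
  · simp [off_of_ne hu, inclA]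

theorem pinchSusp_inclA (x : A.realization) : h.pinchSusp hL (h.inclA x) = h.pole :=
  h.pinchSusp_eq_pole hL (by
    have hx : (h.inclA x).1 w = 0 := h.apply_apex x
    rw [hx]
    norm_num)

theorem pinch_inclA (x : A.realization) :
    h.pinch hL (h.inclA x) = Wedge2.inl h.baseA h.pole x := by
  unfold pinch
  rw [Wedge2.pair_of_right _ _ _ (h.pinchSusp_inclA hL x), pinchA_inclA]

end Maps

end IsSplit

end FaceComplex

/-! ### The homotopies showing that pinching is an equivalence -/

namespace FaceComplex.IsSplit

variable {V : Type} [Fintype V] {Δ A C : FaceComplex V} {w v : V}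

theorem unpinchMap_comp_pinch (h : IsSplit Δ A C w v)
    (hL : ∀ s ∈ Δ.faces, w ∉ s → s ∈ A.faces) :
    (h.unpinchMap.comp (h.pinch hL)).HomotopicRel (ContinuousMap.id _) {h.inclA h.baseA} := by
  classical
  -- Both halves of the composite have one description: the part off `w` is scaled by `|1 - 2 x w|`,
  -- and a signed weight `c` is put on `w` if positive, on `v` if negative. The two branches of `c`
  -- cross at `x w = 1/2`, with value `-1/4`. Interpolating linearly to scale `1` and weight `x w`
  -- reaches the identity without `v` and `w` being weighted together.
  let α : I × Δ.realization → ℝ := fun z => (1 - (z.1 : ℝ)) * |1 - 2 * z.2.1 w| + z.1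
  let c : I × Δ.realization → ℝ := fun z =>
    (1 - (z.1 : ℝ)) * max (-(z.2.1 w / 2)) (z.2.1 w - 3 / 4) + z.1 * z.2.1 w
  have hw : Continuous fun z : I × Δ.realization => z.2.1 w := continuous_snd.coord w
  have hs : Continuous fun z : I × Δ.realization => (z.1 : ℝ) := by fun_prop
  have hα : Continuous α := by fun_prop
  have hc : Continuous c := by fun_prop
  have hα0 : ∀ z, 0 ≤ α z := fun z =>
    add_nonneg (mul_nonneg (sub_nonneg.2 z.1.2.2) (abs_nonneg _)) z.1.2.1
  have hc0 : ∀ z : I × Δ.realization, z.2.1 w = 0 → c z = 0 := by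
    intro z hz
    simp only [c, hz]
    norm_num
  -- The total weight could vanish only if `α = 0`, so time `0` and `x w = 1/2`, where `c = -1/4`,
  -- or if `x w = 1`, where `c > 0`.
  have hpos : ∀ z, 0 < α z * (1 - z.2.1 w) + |c z| := by
    intro z
    obtain ⟨h0, h1⟩ := coord_mem z.2 w
    obtain ⟨h2, h3⟩ := z.1.2
    have h4 := mul_nonneg (hα0 z) (sub_nonneg.2 h1)
    refine lt_of_le_of_ne (add_nonneg h4 (abs_nonneg _)) fun h5 => ?_
    have h6 : α z * (1 - z.2.1 w) = 0 := by linarith [abs_nonneg (c z)]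
    have h7 : c z = 0 := by
      rw [← abs_eq_zero]; linarith [abs_nonneg (c z)]
    rcases mul_eq_zero.1 h6 with h8 | h8
    · have h9 : 0 ≤ (1 - (z.1 : ℝ)) * |1 - 2 * z.2.1 w| :=
        mul_nonneg (sub_nonneg.2 h3) (abs_nonneg _)
      have h10 : (z.1 : ℝ) = 0 := by simp only [α] at h8; linarith
      have h11 : z.2.1 w = 1 / 2 := by
        simp only [α, h10] at h8
        have := abs_eq_zero.1 (by linarith : |1 - 2 * z.2.1 w| = 0)
        linarith
      simp only [c, h10, h11] at h7
      norm_num at h7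
    · have h9 : z.2.1 w = 1 := by linarith
      simp only [c, h9] at h7
      norm_num at h7
      linarith
  refine homotopicRel_of_function (h.toTotal (fun z => off w z.2.1) α (fun z => max 0 (-c z))
    (fun z => max 0 (c z)) (continuous_off.comp continuous_snd) hα (by fun_prop) (by fun_prop)
    (fun z => off_nonneg z.2) hα0 (fun _ => le_max_left _ _) (fun _ => le_max_left _ _) ?_ ?_ ?_)
    (ContinuousMap.continuous _) ?_ ?_ ?_
  · intro z
    rw [sum_off]
    refine (hpos z).trans_le ?_
    have h1 := le_max_left 0 (-c z)
    have h2 := le_max_right 0 (-c z)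
    have h3 := le_max_left 0 (c z)
    have h4 := le_max_right 0 (c z)
    rcases abs_cases (c z) with h5 | h5 <;> linarith
  · intro z
    rcases le_total (c z) 0 with h1 | h1
    · exact Or.inr (max_eq_left h1)
    · exact Or.inl (max_eq_left (neg_nonpos.2 h1))
  · intro z
    refine (supp_off_cases h hL z.2).imp id fun h1 => ?_
    rw [hc0 z h1.1]
    simpa using h1.2
  · intro x
    obtain ⟨h0, h1⟩ := coord_mem x w
    rcases le_total (x.1 w) (1 / 2) with hx | hx
    · have hp : h.pinch hL x = Wedge2.inl h.baseA h.pole (h.pinchA hL x) := by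
        exact Wedge2.pair_of_right _ _ _ (h.pinchSusp_eq_pole hL hx)
      change _ = h.unpinchMap (h.pinch hL x)
      rw [hp]
      refine Subtype.ext ?_
      change _ = (h.pinchA hL x).1
      unfold toTotal pinchA toA
      refine homogeneousMap_val_congr fun u => ?_
      have hα' : α (0, x) = max 0 (1 - 2 * x.1 w) := by
        rw [max_eq_right (by linarith)]
        simp only [α]
        rw [abs_of_nonneg (by linarith)]
        norm_num
      have hc' : c (0, x) = -(x.1 w / 2) := by
        simp only [c]
        rw [max_eq_left (by linarith)]
        norm_num
      have h2 : max 0 (x.1 w / 2) = x.1 w / 2 := max_eq_right (by linarith)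
      have h3 : max 0 (-(x.1 w / 2)) = 0 := max_eq_left (by linarith)
      simp only [hα', hc', neg_neg, h2, h3, ite_self, add_zero]
    · have hp : h.pinch hL x = Wedge2.inr h.baseA h.pole (h.pinchSusp hL x) := by
        exact Wedge2.pair_of_left _ _ _ (h.pinchA_eq_base hL hx)
      change _ = h.unpinchMap (h.pinch hL x)
      rw [hp]
      change _ = h.unpinch (h.pinchSusp hL x)
      obtain ⟨N, hN, hN1, hN2, hN3⟩ := h.exists_pinchSusp_coord hL x
      unfold toTotal
      refine homogeneousMap_eq hN fun u => ?_
      rw [unpinch_apply, mul_add, mul_add, hN1, mul_ite, mul_ite, hN2, hN3, mul_zero]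
      have hα' : α (0, x) = max 0 (2 * x.1 w - 1) := by
        rw [max_eq_right (by linarith)]
        simp only [α]
        rw [abs_of_nonpos (by linarith)]
        norm_num
      have hc' : c (0, x) = x.1 w - 3 / 4 := by
        simp only [c]
        rw [max_eq_right (by linarith)]
        norm_num
      simp only [hα', hc', neg_sub]
  · intro x
    obtain ⟨h0, h1⟩ := coord_mem x w
    have hα' : α (1, x) = 1 := by simp [α]
    have hc' : c (1, x) = x.1 w := by simp [c]
    unfold toTotal
    refine homogeneousMap_eq_of_eq fun u => ?_
    simp only [hα', hc', ContinuousMap.id_apply]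
    have h2 : max 0 (x.1 w) = x.1 w := max_eq_right h0
    have h3 : max 0 (-(x.1 w)) = 0 := max_eq_left (by linarith)
    simp only [h2, h3]
    by_cases hu : u = w
    · subst hu; simp [off_self]
    · simp [hu, off_of_ne hu]
  · rintro s x rfl
    have hx : (h.inclA h.baseA).1 w = 0 := h.apply_apex h.baseA
    have hα' : α (s, h.inclA h.baseA) = 1 := by simp [α, hx]
    have hb : (h.unpinchMap.comp (h.pinch hL)) (h.inclA h.baseA) = h.inclA h.baseA := by
      change h.unpinchMap (h.pinch hL _) = _
      rw [pinch_inclA]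
      rfl
    rw [hb]
    unfold toTotal
    refine homogeneousMap_eq_of_eq fun u => ?_
    simp only [hα', hc0 (s, h.inclA h.baseA) hx]
    by_cases hu : u = w
    · subst hu; simp [off_self, hx]
    · simp [off_of_ne hu]

/-- The map `unpinch` fills half of the suspension with the cone at `v` and half with the cone at
`w`. Pinching wraps the `w` half around the suspension and leaves the `v` half in the cone in `A`;
the homotopy shrinks this remainder to `v` while stretching the `w` part over the whole suspension.
-/
theorem pinch_comp_unpinch (h : IsSplit Δ A C w v)
    (hL : ∀ s ∈ Δ.faces, w ∉ s → s ∈ A.faces) :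
    ((h.pinch hL).comp h.unpinch).HomotopicRel (Wedge2.inr h.baseA h.pole) {h.pole} := by
  classical
  -- The sign of `κ` decides the summand: `A` for `κ ≥ 0`, the suspension for `κ ≤ 0`. The number
  -- `d` is the signed pole weight. At time `0` they describe the composite; at time `1`, `κ = -1`
  -- and `d` is the difference of the pole weights, which gives the identity of the suspension.
  let κ : I × C.suspension.realization → ℝ := fun z =>
    (1 - (z.1 : ℝ)) * (1 - 2 * z.2.1 (Sum.inr true)) - z.1
  let d : I × C.suspension.realization → ℝ := fun z =>
    (1 - (z.1 : ℝ)) * (3 / 4 - z.2.1 (Sum.inr true)) +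
      z.1 * (z.2.1 (Sum.inr false) - z.2.1 (Sum.inr true))
  have hT : Continuous fun z : I × C.suspension.realization => z.2.1 (Sum.inr true) :=
    continuous_snd.coord _
  have hF : Continuous fun z : I × C.suspension.realization => z.2.1 (Sum.inr false) :=
    continuous_snd.coord _
  have hκ : Continuous κ := by fun_prop
  have hd : Continuous d := by fun_prop
  have hsum : ∀ z : I × C.suspension.realization, 0 ≤ z.2.1 (Sum.inr false) ∧
      0 ≤ z.2.1 (Sum.inr true) ∧ 0 ≤ 1 - z.2.1 (Sum.inr false) - z.2.1 (Sum.inr true) := by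
    intro z
    refine ⟨realization_nonneg _ _, realization_nonneg _ _, ?_⟩
    rw [← susp_sum]
    exact Finset.sum_nonneg fun u _ => realization_nonneg _ _
  have hpA : ∀ z : I × C.suspension.realization,
      0 < max 0 (κ z) * (1 - z.2.1 (Sum.inr false) - z.2.1 (Sum.inr true)) +
        (z.2.1 (Sum.inr false) + z.2.1 (Sum.inr true) / 2 + z.1) := by
    intro z
    obtain ⟨h1, h2, h3⟩ := hsum z
    have h4 := mul_nonneg (le_max_left 0 (κ z)) h3
    have h5 := z.1.2.1
    refine lt_of_le_of_ne (by positivity) fun h6 => ?_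
    have e1 : z.2.1 (Sum.inr false) = 0 := by linarith
    have e2 : z.2.1 (Sum.inr true) = 0 := by linarith
    have e3 : (z.1 : ℝ) = 0 := by linarith
    simp only [κ, e1, e2, e3] at h6
    norm_num at h6
  -- With `s` the time, `κ ≥ 0` forces `s < 1` and the weight at the pole `true` to be at most
  -- `1/2`; then `d ≥ (1 - s)/4`. Hence the suspension component rests at the base pole while the
  -- `A` component moves.
  have hd0 : ∀ z, 0 ≤ κ z → 0 < d z := by
    intro z hz
    obtain ⟨h1, h2, h3⟩ := hsum z
    obtain ⟨h4, h5⟩ := z.1.2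
    simp only [κ] at hz
    simp only [d]
    have h6 : z.2.1 (Sum.inr true) ≤ 1 / 2 := by
      by_contra! h7
      have h8 := mul_nonneg (sub_nonneg.2 h5) (by linarith : 0 ≤ 2 * z.2.1 (Sum.inr true) - 1)
      have h9 : (z.1 : ℝ) = 0 := by linarith
      rw [h9] at hz
      linarith
    have h7 : (z.1 : ℝ) < 1 := lt_of_le_of_ne h5 fun h8 => by
      rw [h8] at hz; linarith
    have h8 := mul_nonneg h4 h1
    have h9 := mul_nonneg h4 (sub_nonneg.2 h6)
    nlinarith
  have hpS : ∀ z : I × C.suspension.realization,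
      0 < max 0 (-κ z) * (1 - z.2.1 (Sum.inr false) - z.2.1 (Sum.inr true)) +
        (max 0 (d z) + max 0 (-d z)) := by
    intro z
    obtain ⟨h1, h2, h3⟩ := hsum z
    obtain ⟨h4, h5⟩ := z.1.2
    rcases le_or_gt 0 (κ z) with hz | hz
    · have := mul_nonneg (le_max_left 0 (-κ z)) h3
      have := hd0 z hz
      have := le_max_right 0 (d z)
      have := le_max_left 0 (-d z)
      linarith
    · rw [max_eq_right (by linarith : 0 ≤ -κ z)]
      have e0 := le_max_left 0 (d z)
      have e1 := le_max_left 0 (-d z)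
      have e2 := mul_nonneg (neg_nonneg.2 hz.le) h3
      refine lt_of_le_of_ne (by positivity) fun h6 => ?_
      have e3 : max 0 (d z) = 0 := by linarith
      have e4 : max 0 (-d z) = 0 := by linarith
      have e5 : d z = 0 := le_antisymm (e3 ▸ le_max_right 0 (d z))
        (neg_nonpos.1 (e4 ▸ le_max_right 0 (-d z)))
      have e6 : 1 - z.2.1 (Sum.inr false) - z.2.1 (Sum.inr true) = 0 := by
        rw [e3, e4] at h6
        have : -κ z * (1 - z.2.1 (Sum.inr false) - z.2.1 (Sum.inr true)) = 0 := by linarith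
        exact (mul_eq_zero.1 this).resolve_left (by linarith)
      simp only [d] at e5
      rcases susp_poles z.2 with e7 | e7
      · have e8 : z.2.1 (Sum.inr true) = 1 := by linarith
        rw [e7, e8] at e5
        linarith
      · have e8 : z.2.1 (Sum.inr false) = 1 := by linarith
        rw [e7, e8] at e5
        linarith
  let PA : C(I × C.suspension.realization, A.realization) :=
    h.toA (fun z u => z.2.1 (Sum.inl u)) (fun z => max 0 (κ z))
      (fun z => z.2.1 (Sum.inr false) + z.2.1 (Sum.inr true) / 2 + z.1)
      (continuous_susp.comp continuous_snd) (by fun_prop) (by fun_prop)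
      (fun z u => realization_nonneg _ _) (fun _ => le_max_left _ _)
      (fun z => add_nonneg (add_nonneg (hsum z).1 (by linarith [(hsum z).2.1])) z.1.2.1)
      (fun z => by rw [susp_sum]; exact hpA z) (fun z => Or.inl (susp_supp z.2))
  let PS : C(I × C.suspension.realization, C.suspension.realization) :=
    h.toSusp (fun z u => z.2.1 (Sum.inl u)) (fun z => max 0 (-κ z))
      (fun z => max 0 (d z)) (fun z => max 0 (-d z))
      (continuous_susp.comp continuous_snd) (by fun_prop) (by fun_prop) (by fun_prop)
      (fun z u => realization_nonneg _ _) (fun _ => le_max_left _ _) (fun _ => le_max_left _ _)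
      (fun _ => le_max_left _ _) (fun z => by rw [susp_sum]; exact hpS z)
      (fun z => by
        rcases le_total (d z) 0 with h1 | h1
        · exact Or.inl (max_eq_left h1)
        · exact Or.inr (max_eq_left (neg_nonpos.2 h1))) (fun z => Or.inl (susp_supp z.2))
  have hPA : ∀ z, κ z ≤ 0 → PA z = h.baseA := by
    intro z hz
    have h0 := max_eq_left hz
    have h1 := hpA z
    rw [h0] at h1
    unfold PA toA
    refine homogeneousMap_eq
      (c := z.2.1 (Sum.inr false) + z.2.1 (Sum.inr true) / 2 + z.1) (by linarith) fun u => ?_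
    simp [h0, baseA, vertexPt_apply]
  have hPS : ∀ z, 0 < d z → (∀ u, max 0 (-κ z) * z.2.1 (Sum.inl u) = 0) → PS z = h.pole := by
    intro z hz h0
    unfold PS toSusp
    refine homogeneousMap_eq (c := d z) hz.ne' ?_
    rintro (u | (_ | _))
    · simp [h0, pole, vertexPt_apply]
    · simp [max_eq_right hz.le, pole, vertexPt_apply]
    · simp [hz.le, pole, vertexPt_apply]
  have hpole : ∀ u, h.pole.1 (Sum.inl u) = 0 ∧ h.pole.1 (Sum.inr false) = 1 ∧
      h.pole.1 (Sum.inr true) = 0 := by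
    intro u
    simp [pole, vertexPt_apply]
  have hPAp : ∀ s, PA (s, h.pole) = h.baseA := by
    intro s
    have hs := s.2.1
    unfold PA toA
    refine homogeneousMap_eq (c := 1 + s) (by linarith) fun u => ?_
    simp [hpole u, baseA, vertexPt_apply]
  have hPSp : ∀ s, PS (s, h.pole) = h.pole := by
    intro s
    obtain ⟨h1, h2⟩ := s.2
    refine hPS _ ?_ fun u => by simp [hpole u]
    simp only [d, hpole v]
    linarith
  have hcases : ∀ z, PA z = h.baseA ∨ PS z = h.pole := by
    intro z
    refine (le_total (κ z) 0).imp (hPA z) fun hz => hPS z (hd0 z hz) fun u => ?_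
    rw [max_eq_left (neg_nonpos.2 hz), zero_mul]
  have hpair : Wedge2.inr h.baseA h.pole = Wedge2.pair h.baseA h.pole (.const _ h.baseA)
      (.id C.suspension.realization) (fun _ => Or.inl rfl) := by
    ext1 y
    exact (Wedge2.pair_of_left (p := h.baseA) (q := h.pole) (.const _ h.baseA)
      (.id C.suspension.realization) (fun _ => Or.inl rfl) (z := y) rfl).symm
  rw [hpair]
  have hw : ∀ y, (h.unpinch y).1 w = y.1 (Sum.inr true) := by
    intro y
    rw [unpinch_apply, h.susp_apply_apex y]
    simp [h.ne.symm]
  have hoff : ∀ y u, off w (h.unpinch y).1 u =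
      y.1 (Sum.inl u) + if u = v then y.1 (Sum.inr false) else 0 := by
    intro y u
    by_cases hu : u = w
    · subst hu
      simp [off_self, h.susp_apply_apex y, h.ne.symm]
    · rw [off_of_ne hu, unpinch_apply]
      simp [hu]
  have hA0 : ∀ y, PA (0, y) = h.pinchA hL (h.unpinch y) := by
    intro y
    unfold PA pinchA toA
    refine homogeneousMap_congr fun u => ?_
    simp only [hoff, hw, κ]
    by_cases hu : u = v
    · rcases susp_poles y with h1 | h1
      · simp [hu, h1]
      · simp [hu, h1]
    · simp [hu]
  have hS0 : ∀ y, PS (0, y) = h.pinchSusp hL (h.unpinch y) := by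
    intro y
    unfold PS pinchSusp toSusp
    refine homogeneousMap_congr ?_
    simp only [hoff, hw, κ, d]
    rintro (u | (_ | _))
    · rcases susp_poles y with h1 | h1
      · simp [h1]
      · simp [h1]
    · simp
    · simp
  refine Wedge2.pair_homotopicRel ((h.pinchA hL).comp h.unpinch) ((h.pinchSusp hL).comp h.unpinch)
    (fun z => h.pinch_cases hL _) PA PS hcases hA0 hS0 ?_ ?_ ?_ ?_
  · intro y
    refine hPA _ ?_
    simp [κ]
  · intro y
    unfold PS toSusp
    refine homogeneousMap_eq_of_eq ?_
    have h1 := realization_nonneg y (Sum.inr false)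
    have h2 := realization_nonneg y (Sum.inr true)
    rintro (u | (_ | _))
    · simp [κ]
    · rcases susp_poles y with h3 | h3 <;> simp [d, h1, h2, h3]
    · rcases susp_poles y with h3 | h3 <;> simp [d, h1, h2, h3]
  · rintro s y rfl
    rw [ContinuousMap.comp_apply, ← hA0, hPAp, hPAp]
  · rintro s y rfl
    rw [ContinuousMap.comp_apply, ← hS0, hPSp, hPSp]

theorem ptdEquiv_wedge2_of_core (h : IsSplit Δ A C w v)
    (hL : ∀ s ∈ Δ.faces, w ∉ s → s ∈ A.faces) :
    PtdEquiv Δ.realization (h.inclA h.baseA)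
      (Wedge2 A.realization h.baseA C.suspension.realization h.pole) (Wedge2.base _ _) := by
  refine ⟨h.pinch hL, h.unpinchMap, ?_, rfl, h.unpinchMap_comp_pinch hL, ?_⟩
  · rw [pinch_inclA, Wedge2.inl_base]
  · refine Wedge2.homotopicRel ?_ ?_ ?_
    · change h.pinch hL (h.inclA h.baseA) = _
      rw [pinch_inclA, Wedge2.inl_base]
      rfl
    · have : ((h.pinch hL).comp h.unpinchMap).comp (Wedge2.inl _ _) = Wedge2.inl _ _ :=
        ContinuousMap.ext (h.pinch_inclA hL)
      rw [this]
      exact ContinuousMap.HomotopicRel.refl _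
    · exact h.pinch_comp_unpinch hL

/-- A split complex is a wedge. -/
theorem exists_ptdEquiv_wedge2 (h : IsSplit Δ A C w v) :
    ∃ (p : Δ.realization) (q : A.realization) (r : C.suspension.realization),
      PtdEquiv Δ.realization p (Wedge2 A.realization q C.suspension.realization r)
        (Wedge2.base q r) := by
  classical
  obtain ⟨p, hp⟩ := h.ptdEquiv_core (h.core_isSplit.inclA h.core_isSplit.baseA)
  refine ⟨p, _, _, hp.trans (h.core_isSplit.ptdEquiv_wedge2_of_core ?_)⟩
  rintro s ⟨-, hs⟩ hw
  convert hs
  exact (Finset.erase_eq_of_notMem hw).symm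

end FaceComplex.IsSplit

/-! ### Disjoint intervals -/

/-- The set `F ∩ {0, …, n - 1}` contains `k` disjoint intervals of length `t`. -/
def Packs (t : ℕ) (F : ℕ → Prop) : ℕ → ℕ → Prop
  | 0, _ => True
  | k + 1, n => ∃ a, a + t ≤ n ∧ (∀ i, a ≤ i → i < a + t → F i) ∧ Packs t F k a

namespace Packs

variable {t : ℕ} {F G : ℕ → Prop} {k n m : ℕ}

theorem mono_right (h : Packs t F k n) (hnm : n ≤ m) : Packs t F k m := by
  cases k with
  | zero => trivial
  | succ k =>
    obtain ⟨a, h1, h2⟩ := h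
    exact ⟨a, h1.trans hnm, h2⟩

theorem congr_below (h : Packs t F k n) (hFG : ∀ i < n, F i → G i) : Packs t G k n := by
  induction k generalizing n with
  | zero => trivial
  | succ k ih =>
    obtain ⟨a, h1, h2, h3⟩ := h
    exact ⟨a, h1, fun i hi hi' => hFG i (by omega) (h2 i hi hi'),
      ih h3 fun i hi => hFG i (by omega)⟩

theorem of_succ (h : Packs t F (k + 1) n) : Packs t F k n := by
  obtain ⟨a, h1, -, h3⟩ := h
  exact h3.mono_right (by omega)

/-- A vertex meets at most one of the disjoint intervals, so deleting it costs at most one of them.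
-/
theorem remove (h : Packs t F (k + 1) n) (v : ℕ) : Packs t (fun i => F i ∧ i ≠ v) k n := by
  induction k generalizing n with
  | zero => trivial
  | succ k ih =>
    obtain ⟨a, h1, h2, h3⟩ := h
    by_cases hv : a ≤ v
    · exact (h3.congr_below fun i hi hF => ⟨hF, by omega⟩).mono_right (by omega)
    · exact ⟨a, h1, fun i hi hi' => ⟨h2 i hi hi', by omega⟩, ih h3⟩

theorem of_forall (hk : k * t ≤ n) (h : ∀ i < n, F i) : Packs t F k n := by
  induction k generalizing n with
  | zero => trivial
  | succ k ih =>
    rw [add_one_mul] at hk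
    exact ⟨n - t, by omega, fun i hi hi' => h i (by omega), ih (by omega) fun i hi => h i (by omega)⟩

end Packs

/-! ### The path ideal of a path graph and its powers -/

section Ideals

open MvPolynomial

variable {K : Type*} [Field K] {n t : ℕ}

/-- Prepending a neighbour of a vertex of an interval extends the interval by at most one vertex at
an end. -/
theorem support_toFinset_eq_Icc {u v : Fin n} (p : (SimpleGraph.pathGraph n).Walk u v) :
    ∃ a b : Fin n, p.support.toFinset = Finset.Icc a b := by
  induction p with
  | @nil u => exact ⟨u, u, by simp⟩
  | @cons u u' v h p ih =>
    obtain ⟨a, b, hab⟩ := ih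
    have hu' : u' ∈ Finset.Icc a b := by
      rw [← hab, List.mem_toFinset]
      exact p.start_mem_support
    rw [SimpleGraph.pathGraph_adj] at h
    rw [SimpleGraph.Walk.support_cons, List.toFinset_cons, hab]
    rw [Finset.mem_Icc, Fin.le_def, Fin.le_def] at hu'
    refine ⟨min u a, max u b, ?_⟩
    ext i
    simp only [Finset.mem_insert, Finset.mem_Icc, Fin.le_def, Fin.ext_iff, Fin.coe_min, Fin.coe_max]
    omega

theorem exists_ascending_path (s : ℕ) (a : Fin n) (h : a + s < n) :
    ∃ (v : Fin n) (p : (SimpleGraph.pathGraph n).Walk a v), p.IsPath ∧ p.support.length = s + 1 ∧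
      ∀ i ∈ p.support, a ≤ i := by
  induction s generalizing a with
  | zero => exact ⟨a, .nil, by simp, by simp, by simp⟩
  | succ s ih =>
    obtain ⟨v, p, h1, h2, h3⟩ := ih ⟨a + 1, by omega⟩ (by simp only; omega)
    have hadj : (SimpleGraph.pathGraph n).Adj a ⟨a + 1, by omega⟩ := by
      rw [SimpleGraph.pathGraph_adj]
      exact Or.inl rfl
    refine ⟨v, .cons hadj p, ?_, by simp [h2], ?_⟩
    · rw [SimpleGraph.Walk.cons_isPath_iff]
      refine ⟨h1, fun h4 => ?_⟩
      have := h3 _ h4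
      rw [Fin.le_def] at this
      simp at this
    · intro i hi
      rw [SimpleGraph.Walk.support_cons, List.mem_cons] at hi
      rcases hi with rfl | hi
      · exact le_rfl
      · have := h3 i hi
        rw [Fin.le_def] at this ⊢
        simp only at this
        omega

/-- The exponent of the product of the variables in an interval of length `t`. -/
def interval (n t a : ℕ) : Fin n →₀ ℕ :=
  Finsupp.equivFunOnFinite.symm fun i => if a ≤ i ∧ (i : ℕ) < a + t then 1 else 0

theorem interval_apply (a : ℕ) (i : Fin n) :
    interval n t a i = if a ≤ i ∧ (i : ℕ) < a + t then 1 else 0 := rfl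

theorem prod_X_eq_monomial (F : Finset (Fin n)) : ∏ i ∈ F, (X i : MvPolynomial (Fin n) K) =
    monomial (Finsupp.equivFunOnFinite.symm fun i => if i ∈ F then 1 else 0) 1 := by
  rw [monomial_eq, C_1, one_mul, Finsupp.prod_fintype _ _ (by simp)]
  simp [Finset.prod_ite_mem, pow_ite]

theorem prod_support_eq {u v : Fin n} (p : (SimpleGraph.pathGraph n).Walk u v) (hp : p.IsPath)
    (ht : p.support.length = t) : ∃ a : Fin n, a ∈ p.support ∧ (∀ i ∈ p.support, a ≤ i) ∧
      a + t ≤ n ∧ (p.support.map fun i => (X i : MvPolynomial (Fin n) K)).prod =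
        monomial (interval n t a) 1 := by
  obtain ⟨a, b, hab⟩ := support_toFinset_eq_Icc p
  have hmem : ∀ i, i ∈ p.support ↔ a ≤ i ∧ i ≤ b := by
    intro i
    rw [← List.mem_toFinset, hab, Finset.mem_Icc]
  have hu := (hmem u).1 p.start_mem_support
  have hle : a ≤ b := hu.1.trans hu.2
  have hcard : (b : ℕ) + 1 - a = t := by
    rw [← Fin.card_Icc, ← hab, List.toFinset_card_of_nodup hp.support_nodup, ht]
  rw [Fin.le_def] at hle
  have hb := b.2
  refine ⟨a, (hmem a).2 ⟨le_rfl, hle⟩, fun i hi => ((hmem i).1 hi).1, by omega, ?_⟩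
  rw [← List.prod_toFinset _ hp.support_nodup, hab, prod_X_eq_monomial]
  have he : (Finsupp.equivFunOnFinite.symm fun i => if i ∈ Finset.Icc a b then 1 else 0) =
      interval n t a := by
    ext i
    rw [interval_apply]
    change (if i ∈ Finset.Icc a b then 1 else 0) = _
    refine if_congr ?_ rfl rfl
    rw [Finset.mem_Icc, Fin.le_def, Fin.le_def]
    omega
  rw [he]

theorem pathIdeal_pathGraph (ht : 1 ≤ t) : pathIdeal K (SimpleGraph.pathGraph n) t =
    Ideal.span ((fun u => monomial u (1 : K)) '' {u | ∃ a, a + t ≤ n ∧ u = interval n t a}) := by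
  unfold pathIdeal
  congr 1
  ext f
  constructor
  · rintro ⟨u, v, p, hp, hl, rfl⟩
    obtain ⟨a, -, -, h1, h2⟩ := prod_support_eq (K := K) p hp hl
    exact ⟨_, ⟨a, h1, rfl⟩, h2.symm⟩
  · rintro ⟨_, ⟨a, ha, rfl⟩, rfl⟩
    obtain ⟨v, p, hp, hl, hge⟩ := exists_ascending_path (n := n) (t - 1) ⟨a, by omega⟩
      (by simp only; omega)
    rw [Nat.sub_add_cancel ht] at hl
    refine ⟨_, v, p, hp, hl, ?_⟩
    obtain ⟨b, hb, hb', -, h2⟩ := prod_support_eq (K := K) p hp hl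
    have : b = ⟨a, by omega⟩ := le_antisymm (hb' _ p.start_mem_support) (hge _ hb)
    rw [h2, this]

/-- The exponents of the products of `k` generators of the path ideal. -/
def intervalSums (n t k : ℕ) : Set (Fin n →₀ ℕ) :=
  {u | ∃ M : Multiset ℕ, M.card = k ∧ (∀ a ∈ M, a + t ≤ n) ∧ u = (M.map (interval n t)).sum}

theorem pathIdeal_pow (ht : 1 ≤ t) (k : ℕ) : pathIdeal K (SimpleGraph.pathGraph n) t ^ k =
    Ideal.span ((fun u => monomial u (1 : K)) '' intervalSums n t k) := by
  induction k with
  | zero =>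
    rw [pow_zero, Ideal.one_eq_top, eq_comm, Ideal.eq_top_iff_one]
    exact Ideal.subset_span ⟨0, ⟨0, by simp⟩, rfl⟩
  | succ k ih =>
    rw [pow_succ, ih, pathIdeal_pathGraph ht, Ideal.span_mul_span']
    congr 1
    ext f
    constructor
    · rintro ⟨_, ⟨_, ⟨M, h1, h2, rfl⟩, rfl⟩, _, ⟨_, ⟨a, ha, rfl⟩, rfl⟩, rfl⟩
      refine ⟨_, ⟨a ::ₘ M, by simp [h1], ?_, rfl⟩, ?_⟩
      · intro b hb
        rcases Multiset.mem_cons.1 hb with rfl | hb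
        exacts [ha, h2 b hb]
      · simp [monomial_mul, add_comm]
    · rintro ⟨_, ⟨M, h1, h2, rfl⟩, rfl⟩
      obtain ⟨a, ha⟩ := Multiset.card_pos_iff_exists_mem.1 (by omega : 0 < M.card)
      obtain ⟨M, rfl⟩ := Multiset.exists_cons_of_mem ha
      refine ⟨_, ⟨_, ⟨M, by simpa using h1, fun b hb => h2 b (Multiset.mem_cons_of_mem hb), rfl⟩,
        rfl⟩, _, ⟨_, ⟨_, h2 _ (Multiset.mem_cons_self _ _), rfl⟩, rfl⟩, ?_⟩
      simp [monomial_mul, add_comm]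

theorem monomial_mem_span_iff {S : Set (Fin n →₀ ℕ)} {w : Fin n →₀ ℕ} :
    monomial w (1 : K) ∈ Ideal.span ((fun u => monomial u (1 : K)) '' S) ↔ ∃ u ∈ S, u ≤ w := by
  classical
  rw [mem_ideal_span_monomial_image]
  simp [support_monomial]

theorem sum_interval {a : ℕ} (ha : a + t ≤ n) : ∑ i, interval n t a i = t := by
  simp only [interval_apply, Finset.sum_boole]
  rw [show (Finset.univ.filter fun i : Fin n => a ≤ i ∧ (i : ℕ) < a + t) =
    ((Finset.range t).attach.image fun i => ⟨a + i.1, by have := Finset.mem_range.1 i.2; omega⟩) by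
      ext i
      simp only [Finset.mem_filter, Finset.mem_univ, true_and, Finset.mem_image, Finset.mem_attach,
        Subtype.exists, Finset.mem_range, Fin.ext_iff]
      constructor
      · rintro ⟨h1, h2⟩
        exact ⟨i - a, by omega, by omega⟩
      · rintro ⟨j, hj, h⟩
        omega]
  rw [Finset.card_image_of_injective]
  · simp
  · intro x y hxy
    simp only [Fin.mk.injEq] at hxy
    exact Subtype.ext (by omega)

theorem sum_of_mem_intervalSums {k : ℕ} {u : Fin n →₀ ℕ} (hu : u ∈ intervalSums n t k) :
    ∑ i, u i = k * t := by
  obtain ⟨M, rfl, hM, rfl⟩ := hu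
  induction M using Multiset.induction with
  | empty => simp
  | cons a M ih =>
    rw [Multiset.map_cons, Multiset.sum_cons, Multiset.card_cons]
    simp only [Finsupp.add_apply]
    rw [Finset.sum_add_distrib, ih fun b hb => hM b (Multiset.mem_cons_of_mem hb),
      sum_interval (hM a (Multiset.mem_cons_self _ _))]
    ring

/-- All these monomials have degree `kt`, so none properly divides another. Hence every product of
`k` generators is a minimal generator of the power. -/
theorem eq_of_le_of_mem_intervalSums {k : ℕ} {u u' : Fin n →₀ ℕ} (hu : u ∈ intervalSums n t k)
    (hu' : u' ∈ intervalSums n t k) (h : u ≤ u') : u = u' := by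
  ext i
  exact (Finset.sum_eq_sum_iff_of_le fun i _ => h i).1
    ((sum_of_mem_intervalSums hu).trans (sum_of_mem_intervalSums hu').symm) i (Finset.mem_univ i)

theorem minimalMonomials_pathIdeal_pow (ht : 1 ≤ t) (k : ℕ) :
    minimalMonomials (pathIdeal K (SimpleGraph.pathGraph n) t ^ k) = intervalSums n t k := by
  ext u
  simp only [minimalMonomials, pathIdeal_pow ht, monomial_mem_span_iff, Set.mem_ofPred_eq]
  constructor
  · rintro ⟨⟨u', hu', hle⟩, hmin⟩
    have := hmin ⟨u', hu', le_rfl⟩ hle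
    rwa [le_antisymm this hle]
  · intro hu
    refine ⟨⟨u, hu, le_rfl⟩, ?_⟩
    rintro w ⟨u', hu', hle⟩ hw
    rwa [← eq_of_le_of_mem_intervalSums hu' hu (hle.trans hw)]

/-- Exponents at most one mean that the intervals are disjoint and lie in `F`. The one with the
largest left end `a` is taken as the top interval of the packing. -/
theorem packs_of_sum_le {F : Finset (Fin n)} (ht : 1 ≤ t) {k m : ℕ} (hm : m ≤ n) {M : Multiset ℕ}
    (hk : M.card = k) (hM : ∀ a ∈ M, a + t ≤ m)
    (h : ∀ i, (M.map (interval n t)).sum i ≤ if i ∈ F then 1 else 0) :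
    Packs t (fun i => ∃ h : i < n, (⟨i, h⟩ : Fin n) ∈ F) k m := by
  induction k generalizing m M with
  | zero => trivial
  | succ k ih =>
    obtain ⟨a, ha, hmax⟩ : ∃ a ∈ M, ∀ b ∈ M, b ≤ a := by
      have hne : M.toFinset.Nonempty := by
        rw [Multiset.toFinset_nonempty]
        rintro rfl
        simp at hk
      exact ⟨M.toFinset.max' hne, Multiset.mem_toFinset.1 (Finset.max'_mem _ _),
        fun b hb => Finset.le_max' _ _ (Multiset.mem_toFinset.2 hb)⟩
    have ham := hM a ha
    obtain ⟨M, rfl⟩ := Multiset.exists_cons_of_mem ha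
    simp only [Multiset.map_cons, Multiset.sum_cons, Finsupp.add_apply] at h
    have hF : ∀ i, a ≤ i → i < a + t → ∃ h : i < n, (⟨i, h⟩ : Fin n) ∈ F := by
      intro i hi hi'
      refine ⟨by omega, ?_⟩
      have := h ⟨i, by omega⟩
      rw [interval_apply, if_pos ⟨hi, hi'⟩] at this
      by_contra hiF
      rw [if_neg hiF] at this
      omega
    refine ⟨a, ham, hF, ih (by omega) (by simpa using hk) (fun b hb => ?_) fun i =>
      (Nat.le_add_left _ _).trans (h i)⟩
    -- An interval starting at `b ≤ a` and not ending by `a` contains `a`, which would then have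
    -- exponent at least two.
    by_contra hba
    have hle := hmax b (Multiset.mem_cons_of_mem hb)
    obtain ⟨M, rfl⟩ := Multiset.exists_cons_of_mem hb
    have := h ⟨a, by omega⟩
    rw [Multiset.map_cons, Multiset.sum_cons, Finsupp.add_apply, interval_apply, interval_apply,
      if_pos (by simp only; omega), if_pos (by simp only; omega)] at this
    split_ifs at this <;> omega

theorem exists_sum_le_of_packs {F : Finset (Fin n)} {k m : ℕ}
    (h : Packs t (fun i => ∃ h : i < n, (⟨i, h⟩ : Fin n) ∈ F) k m) :
    ∃ M : Multiset ℕ, M.card = k ∧ (∀ a ∈ M, a + t ≤ m) ∧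
      ∀ i : Fin n, (M.map (interval n t)).sum i ≤ (if i ∈ F then 1 else 0) ∧
        (m ≤ i → (M.map (interval n t)).sum i = 0) := by
  induction k generalizing m with
  | zero => exact ⟨0, by simp⟩
  | succ k ih =>
    obtain ⟨a, h1, h2, h3⟩ := h
    obtain ⟨M, h4, h5, h6⟩ := ih h3
    refine ⟨a ::ₘ M, by simp [h4], ?_, fun i => ?_⟩
    · intro b hb
      rcases Multiset.mem_cons.1 hb with rfl | hb
      · exact h1
      · have := h5 b hb
        omega
    · rw [Multiset.map_cons, Multiset.sum_cons, Finsupp.add_apply, interval_apply]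
      obtain ⟨h7, h8⟩ := h6 i
      by_cases hi : a ≤ i ∧ (i : ℕ) < a + t
      · obtain ⟨_, hiF⟩ := h2 i hi.1 hi.2
        rw [h8 hi.1, if_pos hi, if_pos hiF]
        exact ⟨le_rfl, by omega⟩
      · rw [if_neg hi, zero_add]
        exact ⟨h7, fun h9 => h8 (by omega)⟩

theorem prod_mem_squarefreePower_iff (ht : 1 ≤ t) (k : ℕ) (F : Finset (Fin n)) :
    ∏ i ∈ F, (X i : MvPolynomial (Fin n) K) ∈
      squarefreePower (pathIdeal K (SimpleGraph.pathGraph n) t) k ↔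
    Packs t (fun i => ∃ h : i < n, (⟨i, h⟩ : Fin n) ∈ F) k n := by
  rw [squarefreePower, minimalMonomials_pathIdeal_pow ht, prod_X_eq_monomial,
    monomial_mem_span_iff]
  constructor
  · rintro ⟨u, ⟨⟨M, h1, h2, rfl⟩, -⟩, h3⟩
    exact packs_of_sum_le ht le_rfl h1 h2 h3
  · intro h
    obtain ⟨M, h1, h2, h3⟩ := exists_sum_le_of_packs h
    refine ⟨_, ⟨⟨M, h1, h2, rfl⟩, fun i => (h3 i).1.trans (by split_ifs <;> omega)⟩,
      fun i => (h3 i).1⟩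

end Ideals

/-! ### The complexes `Δ_{m,t}^{[k]}` and their splittings -/

/-- The complement of a set of vertices. -/
def Missing {N : ℕ} (G : Finset (Fin N)) (i : ℕ) : Prop := ∀ h : i < N, (⟨i, h⟩ : Fin N) ∉ G

theorem missing_insert {N : ℕ} {_ : DecidableEq (Fin N)} (v : Fin N) (G : Finset (Fin N)) (i : ℕ) :
    Missing (insert v G) i ↔ Missing G i ∧ i ≠ v := by
  simp only [Missing, Finset.mem_insert, Fin.ext_iff, not_or]
  constructor
  · intro h
    refine ⟨fun hi => (h hi).2, fun hi => ?_⟩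
    exact (h (by omega)).1 hi
  · intro h hi
    exact ⟨h.2, h.1 hi⟩

theorem missing_mono {N : ℕ} {G H : Finset (Fin N)} (h : G ⊆ H) {i : ℕ} (hi : Missing H i) :
    Missing G i := fun hiN hG => hi hiN (h hG)

/-- The complex of the sets `G` contained in the first `m` of `N` vertices such that the other
vertices among these contain `k` disjoint intervals of length `t`. -/
def pathComplex (N m k t : ℕ) : FaceComplex (Fin N) where
  faces := {G | (∀ g ∈ G, (g : ℕ) < m) ∧ Packs t (Missing G) k m}
  down_closed := fun _ hs _ hr => ⟨fun g hg => hs.1 g (hr hg),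
    hs.2.congr_below fun _ _ => missing_mono hr⟩

theorem mem_pathComplex {N m k t : ℕ} {G : Finset (Fin N)} : G ∈ (pathComplex N m k t).faces ↔
    (∀ g ∈ G, (g : ℕ) < m) ∧ Packs t (Missing G) k m := Iff.rfl

theorem pathDual_eq (K : Type*) [Field K] {n t : ℕ} (ht : 1 ≤ t) (k : ℕ) :
    pathDual K n t k = pathComplex n n k t := by
  ext G
  rw [mem_pathComplex]
  unfold pathDual
  split_ifs with hk
  · subst hk
    exact ⟨fun _ => ⟨fun g _ => g.2, trivial⟩, fun _ => Set.mem_univ _⟩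
  · have key : Packs t (fun i => ∃ h : i < n, (⟨i, h⟩ : Fin n) ∈ Gᶜ) k n ↔
        Packs t (Missing G) k n := by
      constructor
      · exact fun h => h.congr_below fun i _ hi h' => by simpa using hi.2
      · exact fun h => h.congr_below fun i hi hi' => ⟨hi, by simpa using hi' hi⟩
    constructor
    · rintro ⟨F, hF, rfl⟩
      refine ⟨fun g _ => g.2, key.1 ?_⟩
      rw [compl_compl]
      exact (prod_mem_squarefreePower_iff ht k F).1 (not_not.1 hF)
    · rintro ⟨-, h⟩
      exact ⟨Gᶜ, not_not.2 ((prod_mem_squarefreePower_iff ht k _).2 (key.2 h)),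
        (compl_compl G).symm⟩

/-- This identifies the subcomplexes in a splitting, which live on the larger vertex set, with the
complexes on their own vertices used in the induction. -/
theorem isImage_pathComplex {N m : ℕ} (h : m ≤ N) (k t : ℕ) :
    FaceComplex.IsImage (Fin.castLEEmb h) (pathComplex m m k t) (pathComplex N m k t) := by
  have key : ∀ (r : Finset (Fin m)), ∀ i < m,
      (Missing (r.map (Fin.castLEEmb h)) i ↔ Missing r i) := by
    intro r i hi
    constructor
    · intro h1 h2 h3
      exact h1 (by omega) (Finset.mem_map.2 ⟨_, h3, rfl⟩)
    · intro h1 h2 h3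
      obtain ⟨j, hj, hji⟩ := Finset.mem_map.1 h3
      refine h1 hi ?_
      convert hj
      exact (congrArg Fin.val hji).symm
  ext s
  constructor
  · rintro ⟨h1, h2⟩
    have hs : s = (Finset.univ.filter fun i : Fin m => Fin.castLE h i ∈ s).map
        (Fin.castLEEmb h) := by
      ext g
      simp only [Finset.mem_map, Finset.mem_filter, Finset.mem_univ, true_and]
      constructor
      · intro hg
        exact ⟨⟨g, h1 g hg⟩, hg, rfl⟩
      · rintro ⟨i, hi, rfl⟩
        exact hi
    refine ⟨_, ⟨fun g _ => g.2, h2.congr_below fun i hi hi' => (key _ i hi).1 ?_⟩, hs⟩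
    rwa [← hs]
  · rintro ⟨r, ⟨-, h2⟩, rfl⟩
    refine ⟨fun g hg => ?_, h2.congr_below fun i hi hi' => (key r i hi).2 hi'⟩
    obtain ⟨i, -, rfl⟩ := Finset.mem_map.1 hg
    exact i.2

theorem singleton_mem_pathComplex {N m k t : ℕ} (v : Fin N) (hv : (v : ℕ) < m)
    (hk : k * t ≤ v) : {v} ∈ (pathComplex N m k t).faces := by
  refine ⟨by simpa using hv, (Packs.of_forall hk fun i hi h => ?_).mono_right hv.le⟩
  simp [Fin.ext_iff]
  omega

/-- The intersection of the two parts of the first splitting. -/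
def cutComplex (n k t : ℕ) : FaceComplex (Fin n) where
  faces := {G | (∀ g ∈ G, (g : ℕ) < n - t) ∧ Packs t (Missing G) k (n - t) ∧
    Packs t (Missing G) (k + 1) (n - 1)}
  down_closed := fun _ hs _ hr => ⟨fun g hg => hs.1 g (hr hg),
    hs.2.1.congr_below fun _ _ => missing_mono hr, hs.2.2.congr_below fun _ _ => missing_mono hr⟩

theorem missing_of_le {N m : ℕ} {G : Finset (Fin N)} (h : ∀ g ∈ G, (g : ℕ) < m) {i : ℕ}
    (hi : m ≤ i) : Missing G i := fun _ hG => absurd (h _ hG) (by simpa using hi)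

open Classical in
-- If a packing in the complement of `G` avoids the last vertex, that vertex can be added to `G`.
-- Otherwise the packing uses the last interval of length `t`, which puts `G` in `A`. On the
-- intersection the packing ends before the last vertex.
theorem pathComplex_isSplit {n k t : ℕ} (ht : 1 ≤ t) (hn : (k + 1) * t + t < n) :
    (pathComplex n n (k + 1) t).IsSplit (pathComplex n (n - t) k t) (cutComplex n k t)
      ⟨n - 1, by omega⟩ ⟨n - t - 1, by omega⟩ := by
  have hkt : (k + 1) * t = k * t + t := by ring
  refine ⟨?_, ?_, ?_, ?_, ?_, ?_, ?_⟩
  · rintro G ⟨h1, h2⟩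
    exact ⟨fun g _ => g.2, n - t, by omega, fun i hi _ => missing_of_le h1 hi, h2⟩
  · rintro G ⟨h1, -⟩ hw
    have := h1 _ hw
    simp only at this
    omega
  · rintro G ⟨-, a, h1, h2, h3⟩ hw hA
    refine ⟨fun g _ => g.2, a, h1, fun i hi hi' => ?_, h3.congr_below fun i hi hi' => ?_⟩
    · refine (missing_insert _ _ _).2 ⟨h2 i hi hi', fun h4 => hA ?_⟩
      simp only at h4
      -- The top interval contains `n - 1`, hence is the last one. It misses `G`, so `G` lies below
      -- `n - t` and would belong to `A`.
      have ha : a = n - t := by omega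
      subst ha
      refine ⟨fun g hg => ?_, h3⟩
      by_contra hg'
      exact h2 g (by omega) (by omega) g.2 hg
    · refine (missing_insert _ _ _).2 ⟨hi', ?_⟩
      simp only
      omega
  · refine ⟨fun g _ => g.2, ?_⟩
    refine (Packs.of_forall (n := n - 1) (by omega) fun i hi h => ?_).mono_right (by omega)
    simp [Fin.ext_iff]
    omega
  · exact ⟨by simp, Packs.of_forall (by omega) fun i _ h => by simp⟩
  · intro G
    constructor
    · rintro ⟨h1, h2, h3⟩
      refine ⟨⟨h1, h2⟩, fun g _ => g.2, ?_⟩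
      refine (h3.congr_below fun i hi hi' => ?_).mono_right (by omega)
      refine (missing_insert _ _ _).2 ⟨hi', ?_⟩
      simp only
      omega
    · rintro ⟨⟨h1, h2⟩, -, a, h3, h4, h5⟩
      have h6 : a + t ≤ n - 1 := by
        by_contra h6
        have := (missing_insert _ _ _).1 (h4 (n - 1) (by omega) (by omega))
        exact this.2 rfl
      exact ⟨h1, h2, a, h6, fun i hi hi' => ((missing_insert _ _ _).1 (h4 i hi hi')).1,
        h5.congr_below fun i _ hi => ((missing_insert _ _ _).1 hi).1⟩
  -- The top interval ends by `n - 1`, so it starts at `a ≤ n - t - 1`. The other `k` intervals lie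
  -- below `a` and leave the vertex `n - t - 1` free.
  · rintro G ⟨h1, h2, a, h3, h4, h5⟩
    refine ⟨fun g hg => ?_, ?_⟩
    · rcases (@Finset.mem_insert _ (_) _ _ _).1 hg with rfl | hg
      · simp only
        omega
      · exact h1 g hg
    · refine (h5.congr_below fun i hi hi' => ?_).mono_right (by omega)
      refine (missing_insert _ _ _).2 ⟨hi', ?_⟩
      simp only
      omega

open Classical in
-- A top interval ending by `n - 1` starts no later than `n - t - 1`. If it must avoid this vertex,
-- the whole packing lies below it, which gives the second subcomplex.
theorem cutComplex_isSplit {n k t : ℕ} (ht : 1 ≤ t) (hn : (k + 1) * t + t < n) :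
    (cutComplex n k t).IsSplit (pathComplex n (n - t - 1) k t) (pathComplex n (n - t - 1) (k + 1) t)
      ⟨n - t - 1, by omega⟩ ⟨0, by omega⟩ := by
  have hkt : (k + 1) * t = k * t + t := by ring
  have hcut : ∀ G : Finset (Fin n), Packs t (Missing G) (k + 1) (n - 1) →
      Packs t (Missing G) k (n - t - 1) := by
    rintro G ⟨a, h1, -, h3⟩
    exact h3.mono_right (by omega)
  refine ⟨?_, ?_, ?_, ?_, ?_, ?_, ?_⟩
  · rintro G ⟨h1, h2⟩
    exact ⟨fun g hg => (h1 g hg).trans (by omega), h2.mono_right (by omega), n - t - 1, by omega,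
      fun i hi _ => missing_of_le h1 hi, h2⟩
  · rintro G ⟨h1, -⟩ hw
    have := h1 _ hw
    simp only at this
    omega
  -- Here the condition is vacuous: faces avoiding the apex already lie in the first subcomplex.
  · rintro G ⟨h1, -, h3⟩ hw hA
    refine absurd ⟨fun g hg => ?_, hcut G h3⟩ hA
    have h4 := h1 g hg
    have h5 : (g : ℕ) ≠ n - t - 1 := by
      rintro h5
      exact hw (by convert hg; exact h5.symm)
    omega
  · have h1 : Packs t (Missing {(⟨n - t - 1, by omega⟩ : Fin n)}) (k + 1) (n - t - 1) := by
      refine Packs.of_forall (by omega) fun i hi h => ?_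
      simp [Fin.ext_iff]
      omega
    refine ⟨?_, h1.of_succ.mono_right (by omega), h1.mono_right (by omega)⟩
    simp
    omega
  · exact ⟨by simp, Packs.of_forall (by omega) fun i _ h => by simp⟩
  · intro G
    constructor
    · rintro ⟨h1, h2⟩
      have h3 : ∀ i < n - t - 1, Missing G i → i ≠ n - t - 1 := by omega
      refine ⟨⟨h1, h2.of_succ⟩, fun g hg => ?_,
        (h2.of_succ.congr_below fun i hi hi' => (missing_insert _ _ _).2 ⟨hi', h3 i hi hi'⟩).mono_right
          (by omega),
        (h2.congr_below fun i hi hi' => (missing_insert _ _ _).2 ⟨hi', h3 i hi hi'⟩).mono_right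
          (by omega)⟩
      rcases (@Finset.mem_insert _ (_) _ _ _).1 hg with rfl | hg
      · simp only
        omega
      · exact (h1 g hg).trans (by omega)
    · rintro ⟨⟨h1, h2⟩, -, -, a, h3, h4, h5⟩
      have h6 : a + t ≤ n - t - 1 := by
        by_contra h6
        have := (missing_insert _ _ _).1 (h4 (n - t - 1) (by omega) (by omega))
        exact this.2 rfl
      exact ⟨h1, a, h6, fun i hi hi' => ((missing_insert _ _ _).1 (h4 i hi hi')).1,
        h5.congr_below fun i _ hi => ((missing_insert _ _ _).1 hi).1⟩
  -- With `k + 1` intervals available and only `k` required, one vertex may be sacrificed; vertex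
  -- `0` serves.
  · rintro G ⟨h1, h2⟩
    refine ⟨fun g hg => ?_, (h2.remove 0).congr_below fun i _ hi => (missing_insert _ _ _).2 hi⟩
    rcases (@Finset.mem_insert _ (_) _ _ _).1 hg with rfl | hg
    · simp only
      omega
    · exact h1 g hg

/-! ### Wedge decompositions -/

/-- The realization of `Δ` and the spaces `X i` are path connected, and the realization is
homotopy equivalent to the wedge of the `X i`, for all choices of base points. -/
structure IsWedge {V : Type} [Fintype V] (Δ : FaceComplex V) {ι : Type} (X : ι → Type)
    [∀ i, TopologicalSpace (X i)] : Prop where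
  pathConnectedSpace : PathConnectedSpace Δ.realization
  pathConnectedSpace_summand : ∀ i, PathConnectedSpace (X i)
  ptdEquiv : ∀ (p : Δ.realization) (q : ∀ i, X i),
    PtdEquiv Δ.realization p (Wedge X q) (Wedge.base X q)

namespace IsWedge

variable {V : Type} [Fintype V] {Δ : FaceComplex V} {ι : Type} {X : ι → Type}
  [∀ i, TopologicalSpace (X i)]

/-- One base point of `Δ` suffices: path connectedness passes from the wedge to `Δ`, and then all
base points of the realization are equivalent. -/
theorem mk' (hX : ∀ i, PathConnectedSpace (X i))
    (h : ∀ q : ∀ i, X i, ∃ p, PtdEquiv Δ.realization p (Wedge X q) (Wedge.base X q)) :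
    IsWedge Δ X := by
  classical
  have := Wedge.pathConnectedSpace (p := fun i => Classical.arbitrary (X i)) hX
  obtain ⟨p, hp⟩ := h fun i => Classical.arbitrary (X i)
  have hΔ := hp.pathConnectedSpace
  refine ⟨hΔ, hX, fun p q => ?_⟩
  obtain ⟨p', hp'⟩ := h q
  exact (FaceComplex.ptdEquiv_basePoint p p').trans hp'

theorem congr (h : IsWedge Δ X) {κ : Type} {Y : κ → Type} [∀ i, TopologicalSpace (Y i)]
    (e : ι ≃ κ) (f : ∀ i, X i ≃ₜ Y (e i)) : IsWedge Δ Y := by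
  have := h.pathConnectedSpace
  refine mk' (fun i => ?_) fun q => ⟨Classical.arbitrary _, ?_⟩
  · obtain ⟨i, rfl⟩ := e.surjective i
    have := h.pathConnectedSpace_summand i
    exact (f i).surjective.pathConnectedSpace (f i).continuous
  · exact (h.ptdEquiv _ fun i => (f i).symm (q (e i))).trans
      (Wedge.ptdEquiv_congr e f fun i => (f i).apply_symm_apply _)

theorem of_homeomorph (h : IsWedge Δ X) {V' : Type} [Fintype V'] {Γ : FaceComplex V'}
    (e : Γ.realization ≃ₜ Δ.realization) : IsWedge Γ X := by
  have := h.pathConnectedSpace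
  refine mk' h.pathConnectedSpace_summand fun q => ⟨e.symm (Classical.arbitrary _), ?_⟩
  exact (PtdEquiv.of_homeomorph e _).trans (h.ptdEquiv _ q)

theorem of_unique [Unique ι] (h : PathConnectedSpace Δ.realization)
    (e : Δ.realization ≃ₜ X default) : IsWedge Δ X := by
  refine mk' (fun i => ?_) fun q => ⟨e.symm (q default), ?_⟩
  · rw [Unique.eq_default i]
    exact e.surjective.pathConnectedSpace e.continuous
  · exact Wedge.ptdEquiv_of_unique e (e.apply_symm_apply _)

theorem of_cone [IsEmpty ι] {v : V} [DecidableEq V] (h0 : ∅ ∈ Δ.faces)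
    (h : ∀ s ∈ Δ.faces, insert v s ∈ Δ.faces) : IsWedge Δ X :=
  mk' (fun i => isEmptyElim i) fun q =>
    ⟨_, FaceComplex.ptdEquiv_of_cone (by simpa using h ∅ h0) h X q⟩

open Classical in
theorem of_isSplit {A C : FaceComplex V} {w v : V} (h : Δ.IsSplit A C w v) {ι κ : Type}
    {W : ι ⊕ κ → Type} [∀ i, TopologicalSpace (W i)] (hA : IsWedge A fun i => W (.inl i))
    (hC : IsWedge C.suspension fun i => W (.inr i)) : IsWedge Δ W := by
  refine mk' ?_ fun q => ?_
  · rintro (i | i)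
    exacts [hA.pathConnectedSpace_summand i, hC.pathConnectedSpace_summand i]
  · obtain ⟨p, a, c, hp⟩ := h.exists_ptdEquiv_wedge2
    exact ⟨p, hp.trans (Wedge2.ptdEquiv_sum W q (hA.ptdEquiv _ _) (hC.ptdEquiv _ _))⟩

end IsWedge

/-! ### Routes to the leaves -/

/-- The edges of the graph, without bounds for its vertices. -/
def IsEdge (t : ℕ) (u v : ℕ × ℕ) : Prop :=
  0 < u.2 ∧ u.2 * t + t + 1 ≤ u.1 ∧ (IsEdgeA t u v ∨ IsEdgeB t u v ∨ IsEdgeC t u v)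

/-- The last vertex of a list. -/
def routeEnd (P : List (ℕ × ℕ)) : ℕ × ℕ := P.getLast?.getD (0, 0)

/-- The sum of the labels of the edges between consecutive entries. -/
def routeLabel (t : ℕ) (P : List (ℕ × ℕ)) : ℕ :=
  ((P.zip P.tail).map (fun e => edgeLabel t e.1 e.2)).sum

/-- The directed paths from `u` to a leaf. -/
def routes (t : ℕ) (u : ℕ × ℕ) : Set (List (ℕ × ℕ)) :=
  {P | P.head? = some u ∧ P.IsChain (IsEdge t) ∧
    1 ≤ (routeEnd P).2 ∧ (routeEnd P).1 ≤ (routeEnd P).2 * t + t}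

section Routes

variable {t : ℕ} {u v : ℕ × ℕ} {P : List (ℕ × ℕ)}

theorem exists_eq_cons_of_mem_routes (h : P ∈ routes t u) : ∃ Q, P = u :: Q := by
  cases P with
  | nil => exact absurd h.1 (by simp)
  | cons a Q => exact ⟨Q, by rw [Option.some.inj h.1]⟩

theorem routeEnd_cons (h : P ∈ routes t v) : routeEnd (u :: P) = routeEnd P := by
  obtain ⟨Q, rfl⟩ := exists_eq_cons_of_mem_routes h
  rfl

theorem routeLabel_cons (h : P ∈ routes t v) :
    routeLabel t (u :: P) = edgeLabel t u v + routeLabel t P := by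
  obtain ⟨Q, rfl⟩ := exists_eq_cons_of_mem_routes h
  rfl

theorem cons_mem_routes (he : IsEdge t u v) (h : P ∈ routes t v) : u :: P ∈ routes t u := by
  refine ⟨rfl, ?_, ?_⟩
  · obtain ⟨Q, rfl⟩ := exists_eq_cons_of_mem_routes h
    exact List.IsChain.cons_cons he h.2.1
  · rw [routeEnd_cons h]
    exact h.2.2

theorem exists_of_mem_routes (h : P ∈ routes t u) (hu : ¬ (1 ≤ u.2 ∧ u.1 ≤ u.2 * t + t)) :
    ∃ v, IsEdge t u v ∧ ∃ Q ∈ routes t v, P = u :: Q := by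
  obtain ⟨Q, rfl⟩ := exists_eq_cons_of_mem_routes h
  cases Q with
  | nil => exact absurd h.2.2 hu
  | cons v Q =>
    have h1 := List.isChain_cons_cons.1 h.2.1
    exact ⟨v, h1.1, _, ⟨rfl, h1.2, h.2.2⟩, rfl⟩

theorem eq_singleton_of_mem_routes (h : P ∈ routes t u) (hu : u.1 ≤ u.2 * t + t) : P = [u] := by
  obtain ⟨Q, rfl⟩ := exists_eq_cons_of_mem_routes h
  cases Q with
  | nil => rfl
  | cons v Q =>
    have h1 := (List.isChain_cons_cons.1 h.2.1).1.2.1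
    omega

theorem isEmpty_routes {m : ℕ} : IsEmpty (routes t (m, 0)) := by
  refine ⟨fun P => ?_⟩
  obtain ⟨v, h, -⟩ := exists_of_mem_routes P.2 (by simp)
  exact absurd h.1 (by simp)

variable {m j : ℕ}

theorem isEdge_iff (h : (j + 1) * t + t + 1 ≤ m) : IsEdge t (m, j + 1) v ↔
    v = (m - t, j) ∨ v = (m - t - 1, j) ∨ v = (m - t - 1, j + 1) := by
  obtain ⟨a, b⟩ := v
  simp only [IsEdge, IsEdgeA, IsEdgeB, IsEdgeC, Prod.mk.injEq]
  omega

variable (t m j) in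
/-- Adding the first vertex to a route from its successor. -/
def consRoute (h : (j + 1) * t + t + 1 ≤ m) :
    routes t (m - t, j) ⊕ (routes t (m - t - 1, j) ⊕ routes t (m - t - 1, j + 1)) →
      routes t (m, j + 1) :=
  Sum.elim (fun P => ⟨_, cons_mem_routes ((isEdge_iff h).2 (.inl rfl)) P.2⟩)
    (Sum.elim (fun P => ⟨_, cons_mem_routes ((isEdge_iff h).2 (.inr (.inl rfl))) P.2⟩)
      (fun P => ⟨_, cons_mem_routes ((isEdge_iff h).2 (.inr (.inr rfl))) P.2⟩))

theorem routes_disjoint {P Q : List (ℕ × ℕ)} (hP : P ∈ routes t u) (hQ : Q ∈ routes t v)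
    (h : u ≠ v) : P ≠ Q := by
  rintro rfl
  exact h (Option.some.inj (hP.1.symm.trans hQ.1))

theorem consRoute_bijective (h : (j + 1) * t + t + 1 ≤ m) :
    Function.Bijective (consRoute t m j h) := by
  have hab : (m - t, j) ≠ (m - t - 1, j) := by simp only [ne_eq, Prod.mk.injEq]; omega
  have hac : (m - t, j) ≠ (m - t - 1, j + 1) := by simp
  have hbc : (m - t - 1, j) ≠ (m - t - 1, j + 1) := by simp
  constructor
  · have hcons : ∀ {P Q : List (ℕ × ℕ)}, (m, j + 1) :: P = (m, j + 1) :: Q → P = Q :=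
      fun h => (List.cons.inj h).2
    rintro (⟨P, hP⟩ | ⟨P, hP⟩ | ⟨P, hP⟩) (⟨Q, hQ⟩ | ⟨Q, hQ⟩ | ⟨Q, hQ⟩) hPQ <;>
      have hPQ := hcons (Subtype.ext_iff.1 hPQ)
    · subst hPQ; rfl
    · exact absurd hPQ (routes_disjoint hP hQ hab)
    · exact absurd hPQ (routes_disjoint hP hQ hac)
    · exact absurd hPQ (routes_disjoint hP hQ hab.symm)
    · subst hPQ; rfl
    · exact absurd hPQ (routes_disjoint hP hQ hbc)
    · exact absurd hPQ (routes_disjoint hP hQ hac.symm)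
    · exact absurd hPQ (routes_disjoint hP hQ hbc.symm)
    · subst hPQ; rfl
  · rintro ⟨P, hP⟩
    obtain ⟨v, hv, Q, hQ, rfl⟩ := exists_of_mem_routes hP (by simp only; omega)
    rcases (isEdge_iff h).1 hv with rfl | rfl | rfl
    exacts [⟨.inl ⟨Q, hQ⟩, rfl⟩, ⟨.inr (.inl ⟨Q, hQ⟩), rfl⟩, ⟨.inr (.inr ⟨Q, hQ⟩), rfl⟩]

theorem edgeLabel_A (h : (j + 1) * t + t + 1 ≤ m) : edgeLabel t (m, j + 1) (m - t, j) = 0 :=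
  if_pos ⟨show m = m - t + t by omega, rfl⟩

theorem edgeLabel_B (h : (j + 1) * t + t + 1 ≤ m) :
    edgeLabel t (m, j + 1) (m - t - 1, j) = 1 := by
  have h1 : ¬ IsEdgeA t (m, j + 1) (m - t - 1, j) := fun h1 => by
    have : m = m - t - 1 + t := h1.1
    omega
  exact (if_neg h1).trans (if_pos ⟨show m = m - t - 1 + t + 1 by omega, rfl⟩)

theorem edgeLabel_C : edgeLabel t (m, j + 1) (m - t - 1, j + 1) = 2 :=
  (if_neg fun h => absurd h.2 (by simp)).trans (if_neg fun h => absurd h.2 (by simp))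

end Routes

/-! ### The decomposition of `Δ_{m,t}^{[j]}` -/

/-- The realization of the `α`-fold suspension of `Δ_{m,t}^{[j]}`. -/
abbrev suspendedPathSpace (t : ℕ) (u : ℕ × ℕ) (α : ℕ) : Type :=
  ((pathComplex u.1 u.1 u.2 t).iterSuspension α).realization

theorem nonempty_homeomorph_of_eq {t : ℕ} {u v : ℕ × ℕ} {α β : ℕ} (h : u = v) (h' : α = β) :
    Nonempty (suspendedPathSpace t u α ≃ₜ suspendedPathSpace t v β) := by
  subst h h'
  exact ⟨Homeomorph.refl _⟩

namespace FaceComplex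

theorem suspension_cone {V : Type} {_ : DecidableEq V} {_ : DecidableEq (V ⊕ Bool)} {Δ : FaceComplex V} {v : V}
    (h : ∀ s ∈ Δ.faces, insert v s ∈ Δ.faces) :
    ∀ s ∈ Δ.suspension.faces, insert (Sum.inl v) s ∈ Δ.suspension.faces := by
  rintro s ⟨h1, h2⟩
  refine mem_suspension.2 ⟨?_, by rwa [IsSplit.toRight_insert]⟩
  rw [IsSplit.toLeft_insert]
  exact h _ h1

open Classical in
theorem exists_cone_iterSuspension {V : Type} {Δ : FaceComplex V} {v : V}
    (h : ∀ s ∈ Δ.faces, insert v s ∈ Δ.faces) (α : ℕ) : ∃ w : SuspVertex V α,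
      ∀ s ∈ (Δ.iterSuspension α).faces, insert w s ∈ (Δ.iterSuspension α).faces := by
  induction α with
  | zero => exact ⟨v, h⟩
  | succ α ih =>
    obtain ⟨w, hw⟩ := ih
    exact ⟨_, suspension_cone hw⟩

/-- A suspension of a complex with a vertex is path connected, and so is every double
suspension. -/
theorem pathConnectedSpace_iterSuspension {V : Type} [Fintype V] {Δ : FaceComplex V} {s : ℕ}
    (h0 : ∅ ∈ Δ.faces) (hs : 1 ≤ s) (h : 2 ≤ s ∨ ∃ v, {v} ∈ Δ.faces) :
    PathConnectedSpace (Δ.iterSuspension s).realization := by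
  obtain ⟨s, rfl⟩ : ∃ r, s = r + 1 := ⟨s - 1, by omega⟩
  suffices ∃ v, {v} ∈ (Δ.iterSuspension s).faces by
    obtain ⟨v, hv⟩ := this
    exact pathConnectedSpace_suspension hv
  cases s with
  | zero => exact h.resolve_left (by omega)
  | succ s => exact ⟨_, singleton_inr_mem_suspension (empty_mem_iterSuspension h0 s) true⟩

end FaceComplex

/-- Here `s` is the label sum collected so far. The alternatives in `h3` are the invariant that
keeps everything path connected: no leaf is reached with `s = 0`; one reached with `s = 1` has `m ≥
jt + t`, hence a vertex; with `s ≥ 2` even `{∅}` suspends to a connected space. The hypothesis `h2`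
provides the apex of the cone when `j = 0`. -/
theorem isWedge_pathComplex {t : ℕ} (ht : 1 ≤ t) (m j s : ℕ) (h1 : j * t ≤ m)
    (h2 : j = 0 → 1 ≤ m) (h3 : j * t + t + 1 ≤ m ∨ (1 ≤ s ∧ j * t + t ≤ m) ∨ 2 ≤ s) :
    IsWedge ((pathComplex m m j t).iterSuspension s)
      (fun P : routes t (m, j) => suspendedPathSpace t (routeEnd P) (s + routeLabel t P)) := by
  classical
  induction m using Nat.strong_induction_on generalizing j s with
  | _ m ih =>
  cases j with
  | zero =>
    have := isEmpty_routes (t := t) (m := m)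
    obtain ⟨w, hw⟩ := FaceComplex.exists_cone_iterSuspension (Δ := pathComplex m m 0 t)
      (v := ⟨0, h2 rfl⟩) (fun s hs => ⟨fun g _ => g.2, trivial⟩) s
    exact IsWedge.of_cone
      (FaceComplex.empty_mem_iterSuspension (Δ := pathComplex m m 0 t) ⟨by simp, trivial⟩ s) hw
  | succ j =>
    have hjt : (j + 1) * t = j * t + t := by ring
    by_cases hm : (j + 1) * t + t + 1 ≤ m
    · obtain ⟨w, v, hs1⟩ := (pathComplex_isSplit ht hm).iterSuspension s
      obtain ⟨w', v', hs2⟩ := (cutComplex_isSplit ht hm).iterSuspension (s + 1)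
      -- Lowering `j` and subtracting `t` preserves the strict inequality, so label 0 needs no new
      -- suspension. Label 1 can reach equality and label 2 can fall below it; the one and two added
      -- suspensions compensate exactly.
      have hA := ih (m - t) (by omega) j s (by omega) (by rintro rfl; omega) (by omega)
      have hB := ih (m - t - 1) (by omega) j (s + 1) (by omega) (by rintro rfl; omega) (by omega)
      have hC := ih (m - t - 1) (by omega) (j + 1) (s + 2) (by omega) (by omega) (by omega)
      obtain ⟨eA⟩ := ((isImage_pathComplex (m.sub_le t) j t).iterSuspension s).nonempty_homeomorph
      obtain ⟨eB⟩ := ((isImage_pathComplex (by omega : m - t - 1 ≤ m) j t).iterSuspension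
        (s + 1)).nonempty_homeomorph
      obtain ⟨eC⟩ := ((isImage_pathComplex (by omega : m - t - 1 ≤ m) (j + 1) t).iterSuspension
        (s + 2)).nonempty_homeomorph
      let e := Equiv.ofBijective _ (consRoute_bijective hm)
      refine IsWedge.congr (X := fun i => suspendedPathSpace t (routeEnd (e i))
        (s + routeLabel t (e i))) ?_ e fun i => Homeomorph.refl _
      refine IsWedge.of_isSplit hs1 ?_ (IsWedge.of_isSplit hs2 ?_ ?_)
      · refine (hA.of_homeomorph eA.symm).congr (Equiv.refl _) fun P => Classical.choice ?_
        refine nonempty_homeomorph_of_eq (routeEnd_cons P.2).symm ?_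
        have := routeLabel_cons (u := (m, j + 1)) P.2
        rw [edgeLabel_A hm, zero_add] at this
        exact congrArg _ this.symm
      · refine (hB.of_homeomorph eB.symm).congr (Equiv.refl _) fun P => Classical.choice ?_
        refine nonempty_homeomorph_of_eq (routeEnd_cons P.2).symm ?_
        have := routeLabel_cons (u := (m, j + 1)) P.2
        rw [edgeLabel_B hm] at this
        rw [add_assoc, ← this]
        rfl
      · refine (hC.of_homeomorph eC.symm).congr (Equiv.refl _) fun P => Classical.choice ?_
        refine nonempty_homeomorph_of_eq (routeEnd_cons P.2).symm ?_
        have := routeLabel_cons (u := (m, j + 1)) P.2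
        rw [edgeLabel_C] at this
        rw [add_assoc, ← this]
        rfl
    · have hm' : m ≤ (j + 1) * t + t := by omega
      -- At a leaf no edge starts, so the trivial path is the only route and the complex is its own
      -- single summand.
      let _ : Unique (routes t (m, j + 1)) :=
        { default := ⟨[(m, j + 1)], rfl, List.isChain_singleton _, Nat.succ_pos j, hm'⟩
          uniq := fun P => Subtype.ext (eq_singleton_of_mem_routes P.2 hm') }
      refine IsWedge.of_unique ?_ (Homeomorph.refl _)
      refine FaceComplex.pathConnectedSpace_iterSuspension
        ⟨by simp, Packs.of_forall h1 fun i _ h => by simp⟩ (by omega) ?_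
      by_cases hs : 2 ≤ s
      · exact .inl hs
      -- The invariant forces `s = 1` and `m = (j + 1) * t + t`, so the vertices before the last one
      -- have room for all `j + 1` intervals.
      · exact .inr ⟨⟨m - 1, by omega⟩, singleton_mem_pathComplex _ (by simp only; omega)
          (by simp only; omega)⟩

/-! ### The index set of the wedge -/

section Index

variable {n k t : ℕ}

theorem routeLabel_map (P : List (GVertex n k t)) :
    routeLabel t (P.map Subtype.val) = labelSum P := by
  unfold routeLabel labelSum
  rw [← List.map_tail, List.zip_map, List.map_map]
  rfl

theorem routeEnd_map {P : List (GVertex n k t)} {v : GVertex n k t} (h : P.getLast? = some v) :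
    routeEnd (P.map Subtype.val) = v := by
  simp [routeEnd, h]

theorem map_mem_routes {v : Leaf n k t} {P : List (GVertex n k t)}
    (h : IsDirectedPath n k t v.1 P) : P.map Subtype.val ∈ routes t (n, k) := by
  refine ⟨by simpa using h.1, (List.isChain_map _).2 h.2.2, ?_⟩
  rw [routeEnd_map h.2.1]
  exact v.2

/-- The bounds defining the vertices of the graph hold automatically along edges, so routes in `ℕ ×
ℕ` starting at `(n, k)` are the directed paths of the graph. -/
theorem bounds_of_isEdge {u v : ℕ × ℕ} (h : IsEdge t u v)
    (hu : u.2 ≤ k ∧ u.2 * t ≤ u.1 ∧ u.1 + (k - u.2) * t ≤ n) :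
    v.2 ≤ k ∧ v.2 * t ≤ v.1 ∧ v.1 + (k - v.2) * t ≤ n := by
  obtain ⟨m, j⟩ := u
  obtain ⟨h0, h1, h2⟩ := h
  obtain ⟨j, rfl⟩ : ∃ i, j = i + 1 := ⟨j - 1, by simp only at h0; omega⟩
  rw [show (m, j + 1).2 = j + 1 from rfl, show (m, j + 1).1 = m from rfl] at *
  have hk : (k - j) * t = (k - (j + 1)) * t + t := by
    rw [show k - j = k - (j + 1) + 1 by omega, add_one_mul]
  have hj : (j + 1) * t = j * t + t := add_one_mul _ _
  rcases (isEdge_iff h1).1 ⟨h0, h1, h2⟩ with rfl | rfl | rfl <;> simp only <;> omega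

theorem exists_map_eq (hn : k * t ≤ n) {P : List (ℕ × ℕ)} (h : P ∈ routes t (n, k)) :
    ∃ (v : Leaf n k t) (Q : List (GVertex n k t)), IsDirectedPath n k t v.1 Q ∧
      Q.map Subtype.val = P := by
  obtain ⟨L, rfl⟩ := exists_eq_cons_of_mem_routes h
  have hmem : ∀ v ∈ (n, k) :: L, v.2 ≤ k ∧ v.2 * t ≤ v.1 ∧ v.1 + (k - v.2) * t ≤ n :=
    List.IsChain.induction _ _ h.2.1 (fun _ _ he hu => bounds_of_isEdge he hu) fun _ =>
      ⟨le_rfl, hn, by simp⟩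
  obtain ⟨Q, hQ⟩ : ∃ Q : List (GVertex n k t), Q.map Subtype.val = (n, k) :: L := by
    lift (n, k) :: L to List (GVertex n k t) using hmem with Q
    exact ⟨Q, rfl⟩
  have hne : Q ≠ [] := by
    rintro rfl
    cases hQ
  have hlast := List.getLast?_eq_some_getLast hne
  have hend := h.2.2
  rw [← hQ, routeEnd_map hlast] at hend
  refine ⟨⟨_, hend⟩, Q, ⟨?_, hlast, ?_⟩, hQ⟩
  · rw [← List.head?_map, hQ]
    rfl
  · have hc := h.2.1
    rw [← hQ, List.isChain_map] at hc
    exact hc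

variable (n k t) in
/-- The route of an index of the wedge. -/
def indexRoute : (Σ v : Leaf n k t, Σ α : ℕ, pathsTo n k t v.1 α) → routes t (n, k) :=
  fun i => ⟨i.2.2.1.map Subtype.val, map_mem_routes i.2.2.2.1⟩

/-- The leaf and the label sum are determined by the path, so summing over them just partitions the
set of routes. -/
theorem indexRoute_bijective (hn : k * t ≤ n) : Function.Bijective (indexRoute n k t) := by
  constructor
  · rintro ⟨v, α, P, hP, rfl⟩ ⟨w, β, Q, hQ, rfl⟩ h
    obtain rfl := List.map_injective_iff.2 Subtype.val_injective (Subtype.ext_iff.1 h)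
    obtain rfl := Subtype.ext (Option.some.inj (hP.2.1.symm.trans hQ.2.1))
    rfl
  · rintro ⟨P, hP⟩
    obtain ⟨v, Q, hQ, rfl⟩ := exists_map_eq hn hP
    exact ⟨⟨v, _, Q, hQ, rfl⟩, rfl⟩

variable (n k t) in
/-- The indices of the wedge correspond to the routes. -/
def indexEquiv (ht : 1 ≤ t) (hn : k * t ≤ n) : WedgeIndex n k t ≃ routes t (n, k) :=
  (Equiv.sigmaCongrRight fun v => Equiv.sigmaCongrRight fun α =>
    letI := (finite_pathsTo n k t ht v.1 α).to_subtype
    (Finite.equivFinOfCardEq (Nat.card_coe_set_eq (pathsTo n k t v.1 α))).symm).trans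
    (Equiv.ofBijective _ (indexRoute_bijective hn))

theorem nonempty_homeomorph_summand (K : Type*) [Field K] (ht : 1 ≤ t) (hn : k * t ≤ n)
    (i : WedgeIndex n k t) :
    Nonempty (suspendedPathSpace t (routeEnd (indexEquiv n k t ht hn i).1)
      (0 + routeLabel t (indexEquiv n k t ht hn i).1) ≃ₜ summand K n k t i) := by
  obtain ⟨v, α, c⟩ := i
  let _ := (finite_pathsTo n k t ht v.1 α).to_subtype
  let P : pathsTo n k t v.1 α :=
    (Finite.equivFinOfCardEq (Nat.card_coe_set_eq (pathsTo n k t v.1 α))).symm c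
  unfold summand
  rw [pathDual_eq K ht]
  refine nonempty_homeomorph_of_eq (u := routeEnd (P.1.map Subtype.val))
    (α := 0 + routeLabel t (P.1.map Subtype.val)) (routeEnd_map P.2.1.2.1) ?_
  rw [zero_add, routeLabel_map]
  exact P.2.2

end Index

end

end SquarefreePath

/-- The summands are nonempty, and for every choice of base points in them the realization of
`Δ_{n,t}^{[k]}` is homotopy equivalent to their wedge sum. -/
theorem mainTheorem8 (K : Type*) [Field K] (n k t : ℕ) (ht : 1 ≤ t) (hn : k * t + t < n) :
    (∀ i : WedgeIndex n k t, Nonempty (summand K n k t i)) ∧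
      ∀ p : (∀ i : WedgeIndex n k t, summand K n k t i),
        Nonempty ((pathDual K n t k).realization ≃ₕ Wedge (summand K n k t) p) := by
  have hn' : k * t ≤ n := by omega
  -- The induction starts without suspensions; `n > kt + t` is the first alternative of its
  -- invariant.
  have h := isWedge_pathComplex ht n k 0 hn' (by omega) (by omega)
  have h' : IsWedge (pathComplex n n k t) (summand K n k t) :=
    IsWedge.congr h (indexEquiv n k t ht hn').symm fun P => Classical.choice (by
      obtain ⟨i, rfl⟩ := (indexEquiv n k t ht hn').surjective P
      rw [Equiv.symm_apply_apply]
      exact nonempty_homeomorph_summand K ht hn' i)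
  refine ⟨fun i => (h'.pathConnectedSpace_summand i).nonempty, fun p => ?_⟩
  have := h'.pathConnectedSpace
  rw [pathDual_eq K ht]
  exact (h'.ptdEquiv (Classical.arbitrary _) p).nonempty_homotopyEquiv
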